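/- Let $d\ge 1$, $s\in\mathbb R$ with $s>-1/d$, and $r=1+s$. For a random vector $Z$ in $\mathbb R^d$ with Lebesgue density $g$ let $$h_r(Z)=\frac1{1-r}\log\int_{\mathbb R^d} g(x)^r\,dx\quad(r\ne 1),\qquad h_1(Z)=-\int_{\mathbb R^d} g(x)\log g(x)\,dx ,$$ with values in $[-\infty,\infty]$; put $h_r(Z)=-\infty$ if $Z$ has no density, or if $r=1$ and both the positive and the negative part of $g\log g$ have infinite integral. A function $g:\mathbb R^d\to[0,\infty)$ is called $s$-concave if $$g((1-\lambda)x+\lambda y)\ \ge\ \big((1-\lambda)g(x)^s+\lambda g(y)^s\big)^{1/s}$$ for all $\lambda\in(0,1)$ and all $x,y$ with $g(x)g(y)>0$, the right-hand side being $g(x)^{1-\lambda}g(y)^{\lambda}$ if $s=0$; a probability density is called $s$-concave if it coincides Lebesgue-almost everywhere with an $s$-concave function. Let $f$ be a probability density on $\mathbb R^d$, and write $h_r(f)$ for the entropy $h_r$ of a random vector with density $f$. Consider the statements 1. the density $f$ is $s$-concave; 2. for every $\lambda\in(0,1)$, $h_r(\lambda X+(1-\lambda)Y)\le h_r(X)$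 for all (possibly dependent) random vectors $X,Y$ that both have density $f$; 3. $h_r\big(\frac{X+Y}2\big)\le h_r(X)$ for all (possibly dependent) random vectors $X,Y$ that both have density $f$; and, for an integer $n\ge 2$, 4. (for $n$) for all $\lambda_1,\dots,\lambda_n\ge 0$ with $\sum_{i=1}^n\lambda_i=1$, $$\sup_{X_1,\dots,X_n\sim f} h_r\Big(\sum_{i=1}^n\lambda_iX_i\Big)=h_r(f),$$ the supremum being over all (possibly dependent) random vectors $X_1,\dots,X_n$ each having density $f$. Then 1 implies 2, 2 implies 3, and 1 implies 4 for every $n\ge 2$. If moreover $h_r(f)<+\infty$ (which is automatic when $s>0$), then 1, 2 and 3 are equivalent, and for every fixed integer $n\ge2$ statement 4 for $n$ is equivalent to 1. -/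

import Mathlib

open MeasureTheory ProbabilityTheory

universe u

noncomputable section

/-- The weighted power mean `((1 - t) a ^ s + t b ^ s) ^ (1 / s)` of two positive numbers, which for
`s = 0` is understood in the limiting sense as the geometric mean `a ^ (1 - t) b ^ t`. -/
def powerMean (s t a b : ℝ) : ℝ :=
  if s = 0 then a ^ (1 - t) * b ^ t
  else ((1 - t) * a ^ s + t * b ^ s) ^ (1 / s)

/-- `s`-concavity of a nonnegative function on `ℝ^d`, for real `s`. -/
def IsSConcave {d : ℕ} (s : ℝ) (f : EuclideanSpace ℝ (Fin d) → ℝ) : Prop :=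
  (∀ x, 0 ≤ f x) ∧
    ∀ x y, 0 < f x * f y → ∀ t : ℝ, 0 < t → t < 1 →
      powerMean s t (f x) (f y) ≤ f ((1 - t) • x + t • y)

/-- A (Lebesgue measurable) probability density on `ℝ^d`. -/
structure IsProbabilityDensity {d : ℕ} (f : EuclideanSpace ℝ (Fin d) → ℝ) : Prop where
  aemeasurable : AEMeasurable f volume
  nonneg : ∀ x, 0 ≤ f x
  lintegral_eq_one : ∫⁻ x, ENNReal.ofReal (f x) = 1

/-- The law on `ℝ^d` with Lebesgue density `f`. -/
def lawOfDensity {d : ℕ} (f : EuclideanSpace ℝ (Fin d) → ℝ) :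
    Measure (EuclideanSpace ℝ (Fin d)) :=
  volume.withDensity fun x => ENNReal.ofReal (f x)

/-- The density `f` is `s`-concave. A density is determined by its distribution only up to Lebesgue
null sets, so this means that some version of `f` is an `s`-concave function. -/
def HasSConcaveVersion {d : ℕ} (s : ℝ) (f : EuclideanSpace ℝ (Fin d) → ℝ) : Prop :=
  ∃ g : EuclideanSpace ℝ (Fin d) → ℝ, g =ᵐ[volume] f ∧ IsSConcave s g

/-- The Shannon differential entropy `-∫ g log g` of a law with density `g`, as the difference of
the integrals of the positive and negative parts of `-g log g`. In `EReal` one has `⊤ - ⊤ = ⊥`, so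
the value is `-∞` if both of these are infinite. -/
def shannonEntropy {d : ℕ} (μ : Measure (EuclideanSpace ℝ (Fin d))) : EReal :=
  ((∫⁻ x, ENNReal.ofReal (Real.negMulLog (μ.rnDeriv volume x).toReal) : ENNReal) : EReal) -
    ((∫⁻ x, ENNReal.ofReal (-Real.negMulLog (μ.rnDeriv volume x).toReal) : ENNReal) : EReal)

open Classical in
/-- The Rényi entropy `h_r` of order `r ∈ (0, ∞)` of a probability law on `ℝ^d`, with values in
`[-∞, ∞]`: `(1 - r)⁻¹ log ∫ g ^ r` if the law has a Lebesgue density `g` and `r ≠ 1`, the Shannon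
entropy if it has a density and `r = 1`, and `-∞` if it has no density. -/
def renyiEntropy {d : ℕ} (r : ℝ) (μ : Measure (EuclideanSpace ℝ (Fin d))) : EReal :=
  if μ ≪ volume then
    if r = 1 then shannonEntropy μ
    else ((1 / (1 - r) : ℝ) : EReal) * ENNReal.log (∫⁻ x, μ.rnDeriv volume x ^ r)
  else ⊥

/-- The values of `h_r (∑ i, w i • X i)` over all `n`-tuples of (possibly dependent) random vectors
`X i`, defined on a common probability space, each of which has density `f`. -/
def couplingEntropies {d n : ℕ} (r : ℝ) (f : EuclideanSpace ℝ (Fin d) → ℝ)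
    (w : Fin n → ℝ) : Set EReal :=
  {h | ∃ (Ω : Type u) (_ : MeasurableSpace Ω) (P : Measure Ω) (_ : IsProbabilityMeasure P)
      (X : Fin n → Ω → EuclideanSpace ℝ (Fin d)),
      (∀ i, HasLaw (X i) (lawOfDensity f) P) ∧
        h = renyiEntropy r (P.map fun ω => ∑ i, w i • X i ω)}

/-- `h_r (t X + (1 - t) Y) ≤ h_r X` for all (possibly dependent) random vectors `X`, `Y`, defined on
a common probability space, both of which have density `f`. -/
def MixtureEntropyLE {d : ℕ} (r : ℝ) (f : EuclideanSpace ℝ (Fin d) → ℝ) (t : ℝ) : Prop :=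
  ∀ (Ω : Type u) (_ : MeasurableSpace Ω) (P : Measure Ω) (_ : IsProbabilityMeasure P)
    (X Y : Ω → EuclideanSpace ℝ (Fin d)),
    HasLaw X (lawOfDensity f) P → HasLaw Y (lawOfDensity f) P →
      renyiEntropy r (P.map fun ω => t • X ω + (1 - t) • Y ω) ≤ renyiEntropy r (P.map X)

end

/-! Write Φ for `concaveTransform s` and U(a) = -aΦ(a). A nonnegative f is s-concave exactly when
Φ∘f is concave on {f > 0}; U is concave on [0,∞) with derivative -((1+s)Φ + const); and h_r orders
densities as ∫U(f) does (`renyiEntropy_le_iff`). So the derivative of the entropy functional is, up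
to sign and constants, the very function whose concavity is at stake.

From s-concavity to entropy (`IsSConcave.generalizedEntropy_le`): if Z = Σ λ_i X_i has density g,
the tangent inequality at f gives ∫U(g) ≤ ∫U(f) - (1+s)(E Φ(f(Z)) - E Φ(f(X))) with X ~ f, and
Jensen makes the bracket nonnegative.

Conversely, assume the midpoint inequality for all couplings. Let mass τ from each of x - v and x +
v meet at x, and leave the rest on the diagonal. To first order in τ this changes ∫U(f) by a
positive multiple of Φ(f(x-v)) + Φ(f(x+v)) - 2Φ(f(x)), so for each v midpoint concavity of Φ∘f fails
only on a null set (`MidpointCouplingLE.volume_eq_zero`). The comparison needs ∫U(f) finite: +∞ is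
excluded by hypothesis, -∞ by a coupling whose midpoint has bounded density
(`MidpointCouplingLE.integrable`).

The almost-everywhere statement is upgraded by regularization: g(x) is the supremum of the essential
lower bounds of f near x. Lebesgue density gives g = f almost everywhere, s > -1/d makes g finite,
and g is lower semicontinuous and midpoint concave, hence s-concave
(`AEMidpointConcave.hasSConcaveVersion`). -/

noncomputable section

/-! ### Scalar inequalities for the transform and the entropy integrand. -/

/-- The increasing transform turning `s`-concavity into concavity. -/
def concaveTransform (s a : ℝ) : ℝ := if s = 0 then Real.log a else a ^ s / s

/-- The integrand of the generalized entropy of order `1 + s`. -/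
def entropyIntegrand (s a : ℝ) : ℝ := -(a * concaveTransform s a)

lemma strictMonoOn_concaveTransform (s : ℝ) : StrictMonoOn (concaveTransform s) (Set.Ioi 0) := by
  intro a ha b hb hab
  simp only [Set.mem_Ioi] at ha hb
  unfold concaveTransform
  split_ifs with h
  · exact Real.log_lt_log ha hab
  rcases lt_or_gt_of_ne h with h | h
  · exact div_lt_div_of_neg_of_lt h (Real.rpow_lt_rpow_of_neg ha hab h)
  · exact div_lt_div_of_pos_right (Real.rpow_lt_rpow ha.le hab h) h

lemma concaveTransform_lt_iff {s a b : ℝ} (ha : 0 < a) (hb : 0 < b) :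
    concaveTransform s a < concaveTransform s b ↔ a < b :=
  (strictMonoOn_concaveTransform s).lt_iff_lt ha hb

lemma concaveTransform_le_iff {s a b : ℝ} (ha : 0 < a) (hb : 0 < b) :
    concaveTransform s a ≤ concaveTransform s b ↔ a ≤ b :=
  (strictMonoOn_concaveTransform s).le_iff_le ha hb

lemma continuousAt_concaveTransform (s : ℝ) {a : ℝ} (ha : 0 < a) :
    ContinuousAt (concaveTransform s) a := by
  unfold concaveTransform
  split_ifs with h
  · exact Real.continuousAt_log ha.ne'
  · exact (Real.continuousAt_rpow_const a s (Or.inl ha.ne')).div_const s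

lemma measurable_concaveTransform (s : ℝ) : Measurable (concaveTransform s) := by
  unfold concaveTransform
  split_ifs with h <;> fun_prop

lemma measurable_entropyIntegrand (s : ℝ) : Measurable (entropyIntegrand s) :=
  (measurable_id.mul (measurable_concaveTransform s)).neg

lemma entropyIntegrand_zero (a : ℝ) : entropyIntegrand 0 a = Real.negMulLog a := by
  simp [entropyIntegrand, concaveTransform, Real.negMulLog]

lemma entropyIntegrand_of_ne {s a : ℝ} (hs : -1 < s) (h : s ≠ 0) (ha : 0 ≤ a) :
    entropyIntegrand s a = -(a ^ (1 + s) / s) := by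
  rw [entropyIntegrand, concaveTransform, if_neg h, Real.rpow_one_add' ha (by linarith)]
  ring

@[simp] lemma entropyIntegrand_apply_zero (s : ℝ) : entropyIntegrand s 0 = 0 := by
  simp [entropyIntegrand]

lemma continuousOn_entropyIntegrand {s : ℝ} (hs : -1 < s) :
    ContinuousOn (entropyIntegrand s) (Set.Ici 0) := by
  rcases eq_or_ne s 0 with rfl | h
  · have : entropyIntegrand 0 = Real.negMulLog := funext entropyIntegrand_zero
    rw [this]
    exact Real.continuous_negMulLog.continuousOn
  · refine ContinuousOn.congr (f := fun a => -(a ^ (1 + s) / s)) ?_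
      fun a ha => entropyIntegrand_of_ne hs h ha
    exact ((Real.continuous_rpow_const (by linarith)).div_const s).neg.continuousOn

lemma powerMean_pos {s t a b : ℝ} (ht0 : 0 < t) (ht1 : t < 1) (ha : 0 < a) (hb : 0 < b) :
    0 < powerMean s t a b := by
  have : 0 < 1 - t := by linarith
  unfold powerMean
  split_ifs <;> positivity

/-- For s < 0 both the power 1/s and the division by s reverse order, so the two reversals cancel.
-/
lemma powerMean_le_iff {s t a b c : ℝ} (ht0 : 0 < t) (ht1 : t < 1) (ha : 0 < a) (hb : 0 < b)
    (hc : 0 < c) :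
    powerMean s t a b ≤ c ↔
      (1 - t) * concaveTransform s a + t * concaveTransform s b ≤ concaveTransform s c := by
  have h1 : 0 < 1 - t := by linarith
  unfold powerMean concaveTransform
  split_ifs with h
  · rw [← Real.log_le_log_iff (by positivity) hc, Real.log_mul (by positivity) (by positivity),
      Real.log_rpow ha, Real.log_rpow hb]
  · have hX : 0 < (1 - t) * a ^ s + t * b ^ s := by positivity
    have e : (1 - t) * (a ^ s / s) + t * (b ^ s / s) = ((1 - t) * a ^ s + t * b ^ s) / s := by ring
    rw [e, one_div]
    rcases lt_or_gt_of_ne h with h | h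
    · rw [Real.rpow_inv_le_iff_of_neg hX hc h, div_le_div_right_of_neg h]
    · rw [Real.rpow_inv_le_iff_of_pos hX.le hc.le h, div_le_div_iff_of_pos_right h]

/-- The slope of `-entropyIntegrand s`. -/
def entropySlope (s a : ℝ) : ℝ := (1 + s) * concaveTransform s a + if s = 0 then 1 else 0

/-- Concavity of U: log x ≤ x - 1 for s = 0, otherwise Bernoulli in b/a - 1, whose direction flips
at exponent 1 + s = 1 just as the sign of s does. The value b = 0 is allowed because a density
compared with f may vanish. -/
lemma entropyIntegrand_le_tangent {s a b : ℝ} (hs : -1 < s) (ha : 0 < a) (hb : 0 ≤ b) :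
    entropyIntegrand s b ≤ entropyIntegrand s a - entropySlope s a * (b - a) := by
  rcases eq_or_ne s 0 with rfl | h
  · simp only [entropyIntegrand, entropySlope, concaveTransform, if_true]
    rcases hb.eq_or_lt with rfl | hb
    · simp; linarith
    have h1 := Real.log_le_sub_one_of_pos (div_pos ha hb)
    rw [Real.log_div ha.ne' hb.ne'] at h1
    have h2 := mul_le_mul_of_nonneg_left h1 hb.le
    have h3 : b * (a / b - 1) = a - b := by field_simp
    nlinarith
  · rw [entropyIntegrand_of_ne hs h hb, entropyIntegrand_of_ne hs h ha.le, entropySlope,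
      concaveTransform, if_neg h, if_neg h]
    have hx : b = a * (1 + (b / a - 1)) := by field_simp; ring
    have hx1 : -1 ≤ b / a - 1 := by have := div_nonneg hb ha.le; linarith
    have e1 : b ^ (1 + s) = a ^ (1 + s) * (1 + (b / a - 1)) ^ (1 + s) := by
      conv_lhs => rw [hx]
      rw [Real.mul_rpow ha.le (by linarith)]
    have e2 : ((1 + s) * (a ^ s / s) + 0) * (b - a)
        = a ^ (1 + s) * ((1 + s) * (b / a - 1)) / s := by
      rw [Real.rpow_one_add' ha.le (by linarith)]
      field_simp
      ring
    rw [e1, e2]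
    have hp : 0 < a ^ (1 + s) := by positivity
    rcases lt_or_gt_of_ne h with h | h
    · have := rpow_one_add_le_one_add_mul_self hx1 (p := 1 + s) (by linarith) (by linarith)
      have := mul_le_mul_of_nonneg_left this hp.le
      have := div_le_div_of_nonpos_of_le h.le this
      have e : a ^ (1 + s) * (1 + (1 + s) * (b / a - 1)) / s
        = a ^ (1 + s) / s + a ^ (1 + s) * ((1 + s) * (b / a - 1)) / s := by ring
      linarith
    · have := one_add_mul_self_le_rpow_one_add hx1 (p := 1 + s) (by linarith)
      have := mul_le_mul_of_nonneg_left this hp.le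
      have := div_le_div_of_nonneg_right this h.le
      have e : a ^ (1 + s) * (1 + (1 + s) * (b / a - 1)) / s
        = a ^ (1 + s) / s + a ^ (1 + s) * ((1 + s) * (b / a - 1)) / s := by ring
      linarith

/-- Moving mass towards the midpoint increases the entropy where concavity of the transform
fails. -/
lemma entropyIntegrand_transfer_lt {s τ a b c : ℝ} (hs : -1 < s) (hτ : 0 < τ) (ha : 0 ≤ a)
    (hb : τ < b) (hc : τ < c)
    (h : 2 * concaveTransform s (a + 2 * τ) <
      concaveTransform s (b - τ) + concaveTransform s (c - τ)) :
    0 < (entropyIntegrand s (a + 2 * τ) - entropyIntegrand s a) +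
      (entropyIntegrand s (b - τ) - entropyIntegrand s b) +
      (entropyIntegrand s (c - τ) - entropyIntegrand s c) := by
  -- The tangents are taken at the values after the transfer, so the assumed gap is exactly the gap
  -- between the slopes.
  have h1 := entropyIntegrand_le_tangent hs (show 0 < a + 2 * τ by linarith) ha
  have h2 := entropyIntegrand_le_tangent hs (show 0 < b - τ by linarith) (b := b) (by linarith)
  have h3 := entropyIntegrand_le_tangent hs (show 0 < c - τ by linarith) (b := c) (by linarith)
  have h4 : 2 * entropySlope s (a + 2 * τ) < entropySlope s (b - τ) + entropySlope s (c - τ) := by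
    have := mul_lt_mul_of_pos_left h (show 0 < 1 + s by linarith)
    unfold entropySlope
    linarith
  nlinarith

/-- The power mean with a large number and `b` exceeds `K b` for every constant `K`
smaller than the limit. -/
lemma exists_midpoint_transform_gt {d : ℕ} {s : ℝ} (hd : 1 ≤ d) (hs : -1 / (d : ℝ) < s) :
    ∃ K : ℝ, 2 ^ d < K ∧ ∀ b : ℝ, 0 < b → ∃ T : ℝ, 0 < T ∧ ∀ t, T ≤ t →
      2 * concaveTransform s (K * b) < concaveTransform s t + concaveTransform s b := by
  have hd' : (0 : ℝ) < d := by exact_mod_cast hd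
  rcases lt_trichotomy s 0 with h | h | h
  -- For s < 0 the midpoint power mean of t and b tends to 2^(-1/s) b as t → ∞, and 2^(-1/s) > 2^d
  -- is precisely s > -1/d. For s ≥ 0 the mean is unbounded and any K would do.
  · have h2 : (2 : ℝ) ^ d < 2 ^ (-s⁻¹) := by
      rw [← Real.rpow_natCast]
      refine Real.rpow_lt_rpow_of_exponent_lt one_lt_two ?_
      rw [← inv_neg, lt_inv_comm₀ hd' (by linarith)]
      rw [neg_div, one_div] at hs
      linarith
    obtain ⟨K, hK1, hK2⟩ := exists_between h2
    have hK0 : 0 < K := lt_trans (by positivity) hK1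
    have hK3 : 1 / 2 < K ^ s := by
      have := Real.rpow_lt_rpow_of_neg hK0 hK2 h
      rwa [← Real.rpow_mul (by norm_num), neg_mul, inv_mul_cancel₀ h.ne, Real.rpow_neg_one,
        ← one_div] at this
    refine ⟨K, hK1, fun b hb => ?_⟩
    have hbs : 0 < b ^ s := by positivity
    have hc : 0 < (2 * K ^ s - 1) * b ^ s := mul_pos (by linarith) hbs
    have hlim : Filter.Tendsto (fun t : ℝ => t ^ s) Filter.atTop (nhds 0) := by
      simpa using tendsto_rpow_neg_atTop (y := -s) (by linarith)
    obtain ⟨T, hT⟩ := Filter.eventually_atTop.1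
      ((hlim.eventually (gt_mem_nhds hc)).and (Filter.eventually_gt_atTop 0))
    refine ⟨T, (hT T le_rfl).2, fun t ht => ?_⟩
    simp only [concaveTransform, if_neg h.ne]
    rw [Real.mul_rpow hK0.le hb.le, ← add_div, ← mul_div_assoc]
    refine div_lt_div_of_neg_of_lt h ?_
    have := (hT t ht).1
    linarith
  · subst h
    refine ⟨2 ^ d + 1, by linarith, fun b hb => ?_⟩
    have hpos : (0 : ℝ) < (2 ^ d + 1) * b := by positivity
    refine ⟨((2 ^ d + 1) * b) ^ 2 / b + 1, by positivity, fun t ht => ?_⟩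
    simp only [concaveTransform, if_true]
    have ht0 : 0 < t := lt_of_lt_of_le (by positivity) ht
    rw [← Real.log_mul ht0.ne' hb.ne']
    have : 2 * Real.log ((2 ^ d + 1) * b) = Real.log (((2 ^ d + 1) * b) ^ 2) := by
      rw [Real.log_pow]; norm_num
    rw [this]
    refine Real.log_lt_log (by positivity) ?_
    have h1 : ((2 ^ d + 1) * b) ^ 2 / b < t := by linarith
    rwa [div_lt_iff₀ hb] at h1
  · refine ⟨2 ^ d + 1, by linarith, fun b hb => ?_⟩
    obtain ⟨T, hT⟩ := Filter.eventually_atTop.1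
      (((tendsto_rpow_atTop h).eventually (Filter.eventually_gt_atTop
        (2 * ((2 ^ d + 1) * b) ^ s))).and (Filter.eventually_gt_atTop 0))
    refine ⟨T, (hT T le_rfl).2, fun t ht => ?_⟩
    simp only [concaveTransform, if_neg h.ne']
    rw [← add_div, ← mul_div_assoc]
    refine div_lt_div_of_pos_right ?_ h
    have := (hT t ht).1
    have : 0 < b ^ s := by positivity
    linarith

lemma IsSConcave.concaveOn {d : ℕ} {s : ℝ} {f : EuclideanSpace ℝ (Fin d) → ℝ}
    (hf : IsSConcave s f) : ConcaveOn ℝ {x | 0 < f x} fun x => concaveTransform s (f x) := by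
  have key : ∀ x y, 0 < f x → 0 < f y → ∀ a b : ℝ, 0 ≤ a → 0 ≤ b → a + b = 1 →
      0 < f (a • x + b • y) ∧ a * concaveTransform s (f x) + b * concaveTransform s (f y)
        ≤ concaveTransform s (f (a • x + b • y)) := by
    intro x y hx hy a b ha hb hab
    rcases hb.eq_or_lt with rfl | hb
    · obtain rfl : a = 1 := by linarith
      simpa using hx
    rcases ha.eq_or_lt with rfl | ha
    · obtain rfl : b = 1 := by linarith
      simpa using hy
    obtain rfl : a = 1 - b := by linarith
    have h := hf.2 x y (mul_pos hx hy) b hb (by linarith)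
    have hpos := (powerMean_pos hb (by linarith) hx hy).trans_le h
    exact ⟨hpos, (powerMean_le_iff hb (by linarith) hx hy hpos).1 h⟩
  exact ⟨fun x hx y hy a b ha hb hab => (key x y hx hy a b ha hb hab).1,
    fun x hx y hy a b ha hb hab => (key x y hx hy a b ha hb hab).2⟩

lemma IsSConcave.of_concaveOn {d : ℕ} {s : ℝ} {f : EuclideanSpace ℝ (Fin d) → ℝ}
    (h0 : ∀ x, 0 ≤ f x)
    (hf : ConcaveOn ℝ {x | 0 < f x} fun x => concaveTransform s (f x)) : IsSConcave s f := by
  refine ⟨h0, fun x y hxy t ht0 ht1 => ?_⟩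
  have hx : 0 < f x := (h0 x).lt_of_ne' (left_ne_zero_of_mul hxy.ne')
  have hy : 0 < f y := (h0 y).lt_of_ne' (right_ne_zero_of_mul hxy.ne')
  have h1 : 0 ≤ 1 - t := by linarith
  exact (powerMean_le_iff ht0 ht1 hx hy (hf.1 hx hy h1 ht0.le (by ring))).2
    (hf.2 hx hy h1 ht0.le (by ring))

/-! ### Laws with densities, and Rényi entropy as the integral of U. -/

section Law

variable {d : ℕ} {f g : EuclideanSpace ℝ (Fin d) → ℝ} {s : ℝ}

lemma lawOfDensity_congr (h : f =ᵐ[volume] g) : lawOfDensity f = lawOfDensity g :=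
  withDensity_congr_ae (h.mono fun x hx => by simp [hx])

lemma lawOfDensity_absolutelyContinuous (f : EuclideanSpace ℝ (Fin d) → ℝ) :
    lawOfDensity f ≪ volume :=
  withDensity_absolutelyContinuous _ _

lemma IsProbabilityDensity.congr (hf : IsProbabilityDensity f) (h : f =ᵐ[volume] g)
    (hg : ∀ x, 0 ≤ g x) : IsProbabilityDensity g where
  aemeasurable := hf.aemeasurable.congr h
  nonneg := hg
  lintegral_eq_one := by
    rw [← hf.lintegral_eq_one]
    exact lintegral_congr_ae (h.mono fun x hx => by simp [hx])

lemma IsProbabilityDensity.isProbabilityMeasure (hf : IsProbabilityDensity f) :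
    IsProbabilityMeasure (lawOfDensity f) :=
  ⟨by rw [lawOfDensity, withDensity_apply _ MeasurableSet.univ, Measure.restrict_univ,
    hf.lintegral_eq_one]⟩

lemma IsProbabilityDensity.integrable (hf : IsProbabilityDensity f) : Integrable f :=
  (lintegral_ofReal_ne_top_iff_integrable hf.aemeasurable.aestronglyMeasurable
    (.of_forall hf.nonneg)).1 (by simp [hf.lintegral_eq_one])

lemma IsProbabilityDensity.integral_eq_one (hf : IsProbabilityDensity f) : ∫ x, f x = 1 := by
  rw [integral_eq_lintegral_of_nonneg_ae (.of_forall hf.nonneg)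
    hf.aemeasurable.aestronglyMeasurable, hf.lintegral_eq_one, ENNReal.toReal_one]

lemma rnDeriv_lawOfDensity (hf : AEMeasurable f) :
    (lawOfDensity f).rnDeriv volume =ᵐ[volume] fun x => ENNReal.ofReal (f x) :=
  Measure.rnDeriv_withDensity₀ _ hf.ennreal_ofReal

/-- Provides Borel real-valued densities, both for laws of mixtures and to replace an f that is only
a.e. measurable. -/
lemma exists_density_of_absolutelyContinuous {μ : Measure (EuclideanSpace ℝ (Fin d))}
    [IsProbabilityMeasure μ] (h : μ ≪ volume) :
    ∃ g : EuclideanSpace ℝ (Fin d) → ℝ, Measurable g ∧ IsProbabilityDensity g ∧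
      μ = lawOfDensity g := by
  have hm : Measurable fun x => (μ.rnDeriv volume x).toReal :=
    (Measure.measurable_rnDeriv _ _).ennreal_toReal
  have e : μ = lawOfDensity fun x => (μ.rnDeriv volume x).toReal := by
    conv_lhs => rw [← Measure.withDensity_rnDeriv_eq _ _ h]
    refine withDensity_congr_ae ?_
    filter_upwards [Measure.rnDeriv_lt_top μ volume] with x hx
    rw [ENNReal.ofReal_toReal hx.ne]
  refine ⟨_, hm, ⟨hm.aemeasurable, fun x => ENNReal.toReal_nonneg, ?_⟩, e⟩
  rw [← setLIntegral_univ, ← withDensity_apply _ MeasurableSet.univ]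
  change lawOfDensity _ Set.univ = 1
  rw [← e, measure_univ]

lemma lawOfDensity_add (hf : Measurable f) (hf0 : ∀ x, 0 ≤ f x) (hg0 : ∀ x, 0 ≤ g x) :
    lawOfDensity (fun x => f x + g x) = lawOfDensity f + lawOfDensity g := by
  unfold lawOfDensity
  rw [← withDensity_add_left hf.ennreal_ofReal]
  congr 1
  ext x
  simp [ENNReal.ofReal_add (hf0 x) (hg0 x)]

lemma map_add_lawOfDensity (f : EuclideanSpace ℝ (Fin d) → ℝ)
    (v : EuclideanSpace ℝ (Fin d)) :
    (lawOfDensity f).map (fun x => x + v) = lawOfDensity fun x => f (x - v) := by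
  ext S hS
  have hm : Measurable fun x : EuclideanSpace ℝ (Fin d) => x + v := by fun_prop
  rw [Measure.map_apply hm hS, lawOfDensity, lawOfDensity, withDensity_apply _ hS,
    withDensity_apply _ (hm hS), ← lintegral_indicator hS, ← lintegral_indicator (hm hS),
    ← lintegral_add_right_eq_self (S.indicator fun x => ENNReal.ofReal (f (x - v))) v]
  congr 1
  ext x
  simp [Set.indicator]
  rfl

lemma integrable_lawOfDensity_iff (hf : AEMeasurable f) (hf0 : ∀ x, 0 ≤ f x)
    {φ : EuclideanSpace ℝ (Fin d) → ℝ} :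
    Integrable φ (lawOfDensity f) ↔ Integrable fun x => f x * φ x := by
  rw [lawOfDensity, integrable_withDensity_iff_integrable_smul₀' hf.ennreal_ofReal (by simp)]
  simp [ENNReal.toReal_ofReal (hf0 _)]

lemma integral_lawOfDensity (hf : AEMeasurable f) (hf0 : ∀ x, 0 ≤ f x)
    (φ : EuclideanSpace ℝ (Fin d) → ℝ) :
    ∫ x, φ x ∂lawOfDensity f = ∫ x, f x * φ x := by
  rw [lawOfDensity, integral_withDensity_eq_integral_toReal_smul₀ hf.ennreal_ofReal (by simp)]
  simp [ENNReal.toReal_ofReal (hf0 _)]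

lemma ae_pos_lawOfDensity (hf : AEMeasurable f) : ∀ᵐ x ∂lawOfDensity f, 0 < f x := by
  rw [lawOfDensity, ae_withDensity_iff' hf.ennreal_ofReal]
  exact .of_forall fun x hx => by simpa using hx

/-- The generalized entropy `∫ U (f x) dx` of order `1 + s`, as a difference of the integrals of
the positive and negative parts. -/
def generalizedEntropy (s : ℝ) (f : EuclideanSpace ℝ (Fin d) → ℝ) : EReal :=
  ((∫⁻ x, ENNReal.ofReal (entropyIntegrand s (f x)) : ENNReal) : EReal) -
    ((∫⁻ x, ENNReal.ofReal (-entropyIntegrand s (f x)) : ENNReal) : EReal)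

lemma aestronglyMeasurable_entropyIntegrand (hf : AEMeasurable f) :
    AEStronglyMeasurable (fun x => entropyIntegrand s (f x)) :=
  ((measurable_entropyIntegrand s).comp_aemeasurable hf).aestronglyMeasurable

lemma generalizedEntropy_eq_integral (h : Integrable fun x => entropyIntegrand s (f x)) :
    generalizedEntropy s f = ((∫ x, entropyIntegrand s (f x) : ℝ) : EReal) := by
  rw [integral_eq_lintegral_pos_part_sub_lintegral_neg_part h, EReal.coe_sub,
    EReal.coe_ennreal_toReal h.lintegral_lt_top.ne,
    EReal.coe_ennreal_toReal (x := ∫⁻ x, ENNReal.ofReal (-entropyIntegrand s (f x)))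
      h.neg.lintegral_lt_top.ne]
  rfl

lemma integrable_entropyIntegrand_of_lintegral_ne_top (hf : AEMeasurable f)
    (h1 : ∫⁻ x, ENNReal.ofReal (entropyIntegrand s (f x)) ≠ ⊤)
    (h2 : ∫⁻ x, ENNReal.ofReal (-entropyIntegrand s (f x)) ≠ ⊤) :
    Integrable fun x => entropyIntegrand s (f x) := by
  refine ⟨aestronglyMeasurable_entropyIntegrand hf, ?_⟩
  have : ∀ x, ‖entropyIntegrand s (f x)‖ₑ = ENNReal.ofReal (entropyIntegrand s (f x)) +
      ENNReal.ofReal (-entropyIntegrand s (f x)) := by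
    intro x
    rw [Real.enorm_eq_ofReal_abs]
    rcases le_total 0 (entropyIntegrand s (f x)) with h | h
    · rw [abs_of_nonneg h, ENNReal.ofReal_of_nonpos (p := -_) (by linarith), add_zero]
    · rw [abs_of_nonpos h, ENNReal.ofReal_of_nonpos h, zero_add]
  rw [HasFiniteIntegral, lintegral_congr this, lintegral_add_left' (by
    exact (aestronglyMeasurable_entropyIntegrand hf).aemeasurable.ennreal_ofReal)]
  exact ENNReal.add_lt_top.2 ⟨h1.lt_top, h2.lt_top⟩

lemma integrable_entropyIntegrand_of_ne_top (hf : AEMeasurable f)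
    (h1 : generalizedEntropy s f ≠ ⊤)
    (h2 : ∫⁻ x, ENNReal.ofReal (-entropyIntegrand s (f x)) ≠ ⊤) :
    Integrable fun x => entropyIntegrand s (f x) := by
  refine integrable_entropyIntegrand_of_lintegral_ne_top hf (fun h => h1 ?_) h2
  rw [generalizedEntropy, h, EReal.coe_ennreal_top]
  exact EReal.top_sub (by simpa using h2)

lemma coe_mul_le_coe_mul_iff {c : ℝ} (hc : 0 < c) (x y : EReal) :
    (c : EReal) * x ≤ c * y ↔ x ≤ y := by
  have aux : ∀ z : EReal, ((c⁻¹ : ℝ) : EReal) * ((c : EReal) * z) = z := fun z => by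
    rw [← mul_assoc, ← EReal.coe_mul, inv_mul_cancel₀ hc.ne', EReal.coe_one, one_mul]
  have hc0 : (0 : EReal) ≤ (c : EReal) := by exact_mod_cast hc.le
  have hc1 : (0 : EReal) ≤ ((c⁻¹ : ℝ) : EReal) := by exact_mod_cast (inv_pos.2 hc).le
  refine ⟨fun h => ?_, fun h => mul_le_mul_of_nonneg_left h hc0⟩
  have := mul_le_mul_of_nonneg_left h hc1
  rwa [aux, aux] at this

lemma coe_mul_le_coe_mul_iff_of_neg {c : ℝ} (hc : c < 0) (x y : EReal) :
    (c : EReal) * x ≤ c * y ↔ y ≤ x := by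
  have : ∀ z : EReal, (c : EReal) * z = -(((-c : ℝ) : EReal) * z) := fun z => by
    rw [EReal.coe_neg, EReal.neg_mul, neg_neg]
  rw [this x, this y, EReal.neg_le_neg_iff, coe_mul_le_coe_mul_iff (by linarith)]

lemma renyiEntropy_one_lawOfDensity (hf : AEMeasurable f) (hf0 : ∀ x, 0 ≤ f x) :
    renyiEntropy 1 (lawOfDensity f) = generalizedEntropy 0 f := by
  rw [renyiEntropy, if_pos (lawOfDensity_absolutelyContinuous f), if_pos rfl, shannonEntropy,
    generalizedEntropy]
  have h : ∀ᵐ x, ((lawOfDensity f).rnDeriv volume x).toReal = f x := by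
    filter_upwards [rnDeriv_lawOfDensity hf] with x hx
    rw [hx, ENNReal.toReal_ofReal (hf0 x)]
  congr 2
  · refine lintegral_congr_ae (h.mono fun x hx => ?_)
    simp only [hx, entropyIntegrand_zero]
  · refine lintegral_congr_ae (h.mono fun x hx => ?_)
    simp only [hx, entropyIntegrand_zero]

lemma renyiEntropy_lawOfDensity_of_ne (hs : -1 < s) (h : s ≠ 0) (hf : AEMeasurable f)
    (hf0 : ∀ x, 0 ≤ f x) :
    renyiEntropy (1 + s) (lawOfDensity f) =
      ((1 / (1 - (1 + s)) : ℝ) : EReal) * ENNReal.log (∫⁻ x, ENNReal.ofReal (f x ^ (1 + s))) := by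
  rw [renyiEntropy, if_pos (lawOfDensity_absolutelyContinuous f), if_neg (by simpa using h)]
  congr 2
  refine lintegral_congr_ae ((rnDeriv_lawOfDensity hf).mono fun x hx => ?_)
  simp only [hx]
  rw [ENNReal.ofReal_rpow_of_nonneg (hf0 x) (by linarith)]

lemma generalizedEntropy_of_neg (hs : -1 < s) (h : s < 0) (hf0 : ∀ x, 0 ≤ f x) :
    generalizedEntropy s f =
      ((ENNReal.ofReal (-s)⁻¹ * ∫⁻ x, ENNReal.ofReal (f x ^ (1 + s)) : ENNReal) : EReal) := by
  have e1 : ∀ x, ENNReal.ofReal (entropyIntegrand s (f x)) =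
      ENNReal.ofReal (-s)⁻¹ * ENNReal.ofReal (f x ^ (1 + s)) := fun x => by
    rw [entropyIntegrand_of_ne hs h.ne (hf0 x), ← ENNReal.ofReal_mul (by
      rw [inv_nonneg]; linarith)]
    congr 1
    rw [inv_neg]; ring
  have e2 : ∀ x, ENNReal.ofReal (-entropyIntegrand s (f x)) = 0 := fun x => by
    rw [entropyIntegrand_of_ne hs h.ne (hf0 x), neg_neg]
    exact ENNReal.ofReal_of_nonpos
      (div_nonpos_of_nonneg_of_nonpos (Real.rpow_nonneg (hf0 x) _) h.le)
  rw [generalizedEntropy, lintegral_congr e1, lintegral_congr e2,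
    lintegral_const_mul' _ _ ENNReal.ofReal_ne_top]
  simp

lemma generalizedEntropy_of_pos (h : 0 < s) (hf0 : ∀ x, 0 ≤ f x) :
    generalizedEntropy s f =
      -((ENNReal.ofReal s⁻¹ * ∫⁻ x, ENNReal.ofReal (f x ^ (1 + s)) : ENNReal) : EReal) := by
  have hs : -1 < s := by linarith
  have e1 : ∀ x, ENNReal.ofReal (-entropyIntegrand s (f x)) =
      ENNReal.ofReal s⁻¹ * ENNReal.ofReal (f x ^ (1 + s)) := fun x => by
    rw [entropyIntegrand_of_ne hs h.ne' (hf0 x), ← ENNReal.ofReal_mul (by positivity)]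
    congr 1
    ring
  have e2 : ∀ x, ENNReal.ofReal (entropyIntegrand s (f x)) = 0 := fun x => by
    rw [entropyIntegrand_of_ne hs h.ne' (hf0 x)]
    have := div_nonneg (Real.rpow_nonneg (hf0 x) (1 + s)) h.le
    exact ENNReal.ofReal_of_nonpos (by linarith)
  rw [generalizedEntropy, lintegral_congr e1, lintegral_congr e2,
    lintegral_const_mul' _ _ ENNReal.ofReal_ne_top]
  simp

/-- For s ≠ 0 the two functionals are -1/s times the logarithm of ∫f^(1+s) and -1/s times that
integral itself; for s = 0 they coincide. Infinite values are covered. -/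
lemma renyiEntropy_le_iff (hs : -1 < s) (hf : AEMeasurable f) (hf0 : ∀ x, 0 ≤ f x)
    (hg : AEMeasurable g) (hg0 : ∀ x, 0 ≤ g x) :
    renyiEntropy (1 + s) (lawOfDensity g) ≤ renyiEntropy (1 + s) (lawOfDensity f) ↔
      generalizedEntropy s g ≤ generalizedEntropy s f := by
  rcases lt_trichotomy s 0 with h | rfl | h
  · rw [renyiEntropy_lawOfDensity_of_ne hs h.ne hf hf0,
      renyiEntropy_lawOfDensity_of_ne hs h.ne hg hg0, generalizedEntropy_of_neg hs h hf0,
      generalizedEntropy_of_neg hs h hg0, coe_mul_le_coe_mul_iff (by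
        rw [one_div_pos]; linarith), ENNReal.log_le_log_iff, EReal.coe_ennreal_le_coe_ennreal_iff,
      ENNReal.mul_le_mul_iff_right (by simpa using h) ENNReal.ofReal_ne_top]
  · rw [add_zero, renyiEntropy_one_lawOfDensity hf hf0, renyiEntropy_one_lawOfDensity hg hg0]
  · rw [renyiEntropy_lawOfDensity_of_ne hs h.ne' hf hf0,
      renyiEntropy_lawOfDensity_of_ne hs h.ne' hg hg0, generalizedEntropy_of_pos h hf0,
      generalizedEntropy_of_pos h hg0, coe_mul_le_coe_mul_iff_of_neg (by
        rw [one_div_neg]; linarith), ENNReal.log_le_log_iff, EReal.neg_le_neg_iff,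
      EReal.coe_ennreal_le_coe_ennreal_iff,
      ENNReal.mul_le_mul_iff_right (by simpa using h) ENNReal.ofReal_ne_top]

lemma generalizedEntropy_ne_top (hs : -1 < s) (hf : AEMeasurable f) (hf0 : ∀ x, 0 ≤ f x)
    (h : renyiEntropy (1 + s) (lawOfDensity f) ≠ ⊤) : generalizedEntropy s f ≠ ⊤ := by
  rcases lt_trichotomy s 0 with hs0 | rfl | hs0
  · rw [renyiEntropy_lawOfDensity_of_ne hs hs0.ne hf hf0] at h
    rw [generalizedEntropy_of_neg hs hs0 hf0]
    contrapose! h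
    rw [EReal.coe_ennreal_eq_top_iff, ENNReal.mul_eq_top] at h
    have : ∫⁻ x, ENNReal.ofReal (f x ^ (1 + s)) = ⊤ := by simpa [hs0] using h
    rw [this, ENNReal.log_top, EReal.coe_mul_top_of_pos]
    rw [one_div_pos]; linarith
  · rwa [add_zero, renyiEntropy_one_lawOfDensity hf hf0] at h
  · rw [generalizedEntropy_of_pos hs0 hf0, Ne, EReal.neg_eq_top_iff]
    exact EReal.coe_ennreal_ne_bot _

/-- A bounded density has finite negative part of the entropy. -/
lemma lintegral_neg_entropyIntegrand_ne_top_of_le {C : ℝ} (hf : IsProbabilityDensity f)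
    (hC : 0 < C) (h : ∀ᵐ x, f x ≤ C) :
    ∫⁻ x, ENNReal.ofReal (-entropyIntegrand s (f x)) ≠ ⊤ := by
  refine ne_top_of_le_ne_top (b := ENNReal.ofReal |concaveTransform s C|) ENNReal.ofReal_ne_top ?_
  calc ∫⁻ x, ENNReal.ofReal (-entropyIntegrand s (f x))
      ≤ ∫⁻ x, ENNReal.ofReal |concaveTransform s C| * ENNReal.ofReal (f x) := by
        refine lintegral_mono_ae (h.mono fun x hx => ?_)
        rw [← ENNReal.ofReal_mul (abs_nonneg _), mul_comm]
        refine ENNReal.ofReal_le_ofReal ?_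
        rw [entropyIntegrand, neg_neg]
        rcases (hf.nonneg x).eq_or_lt with h0 | h0
        · simp [← h0]
        · exact mul_le_mul_of_nonneg_left
            (((concaveTransform_le_iff h0 hC).2 hx).trans (le_abs_self _)) h0.le
    _ = _ := by
        rw [lintegral_const_mul' _ _ ENNReal.ofReal_ne_top, hf.lintegral_eq_one, mul_one]

end Law

/-! ### From s-concavity to the entropy inequality. -/

section Forward

variable {d : ℕ} {f g : EuclideanSpace ℝ (Fin d) → ℝ} {s : ℝ}

/-- For s ≥ 0 the power mean dominates the geometric mean, by AM-GM. -/
lemma mul_le_sq_of_concaveTransform {s a b c : ℝ} (hs : 0 ≤ s) (ha : 0 < a) (hb : 0 < b)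
    (hc : 0 < c)
    (h : (1 / 2) * concaveTransform s a + (1 / 2) * concaveTransform s b ≤ concaveTransform s c) :
    a * b ≤ c ^ 2 := by
  rcases hs.eq_or_lt with rfl | hs
  · simp only [concaveTransform, if_true] at h
    rw [← Real.log_le_log_iff (by positivity) (by positivity), Real.log_mul ha.ne' hb.ne',
      Real.log_pow]
    push_cast
    linarith
  · simp only [concaveTransform, if_neg hs.ne'] at h
    have h1 : a ^ s + b ^ s ≤ 2 * c ^ s := by
      field_simp at h
      linarith
    have ha' : 0 < a ^ s := by positivity
    have hb' : 0 < b ^ s := by positivity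
    have h2 : a ^ s * b ^ s ≤ (c ^ s) ^ 2 := by nlinarith [sq_nonneg (a ^ s - b ^ s)]
    rw [← Real.mul_rpow ha.le hb.le, ← Real.rpow_natCast, ← Real.rpow_mul hc.le, mul_comm s,
      Real.rpow_mul hc.le] at h2
    have := (Real.rpow_le_rpow_iff (by positivity) (by positivity) hs).1 h2
    exact_mod_cast this

lemma exists_pos_measure_superlevel (hf : IsProbabilityDensity f) :
    ∃ b : ℝ, 0 < b ∧ volume {x | b < f x} ≠ 0 := by
  by_contra! h
  have h0 : volume (⋃ n : ℕ, {x | 1 / ((n : ℝ) + 1) < f x}) = 0 :=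
    measure_iUnion_null fun n => h _ (by positivity)
  have h1 : ∀ᵐ x, ENNReal.ofReal (f x) = 0 := by
    have : ∀ᵐ x, x ∉ ⋃ n : ℕ, {x | 1 / ((n : ℝ) + 1) < f x} := by
      rw [ae_iff]
      simp only [not_not]
      exact h0
    filter_upwards [this] with x hx
    rw [ENNReal.ofReal_eq_zero]
    by_contra! hpos
    obtain ⟨n, hn⟩ := exists_nat_one_div_lt hpos
    exact hx (Set.mem_iUnion.2 ⟨n, hn⟩)
  have h2 := hf.lintegral_eq_one
  rw [lintegral_congr_ae h1] at h2
  simp at h2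

lemma volume_preimage_reflection (x₀ : EuclideanSpace ℝ (Fin d))
    (B : Set (EuclideanSpace ℝ (Fin d))) :
    volume {m | (2 : ℝ) • m - x₀ ∈ B} = ENNReal.ofReal (2 ^ d)⁻¹ * volume B := by
  have e : {m | (2 : ℝ) • m - x₀ ∈ B} = ((2 : ℝ) • ·) ⁻¹' ((fun y => y + -x₀) ⁻¹' B) := by
    ext m; simp [sub_eq_add_neg]
  rw [e, Measure.addHaar_preimage_smul _ (by norm_num), measure_preimage_add_right]
  simp

/-- Fix B = {f > b} of positive volume. At midpoints of x₀ with points of B, f is at least √(f(x₀)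
b), and these midpoints fill volume 2^(-d)|B|; Markov's inequality with ∫f = 1 then bounds f(x₀)
independently of x₀. -/
lemma IsSConcave.bounded (hs : 0 ≤ s) (hf : IsProbabilityDensity f) (hc : IsSConcave s f) :
    ∃ C : ℝ, 0 < C ∧ ∀ x, f x ≤ C := by
  obtain ⟨b, hb, hB⟩ := exists_pos_measure_superlevel hf
  set B := {x | b < f x}
  set c := ENNReal.ofReal (2 ^ d)⁻¹ * volume B with hcdef
  have hc0 : c ≠ 0 := mul_ne_zero (by simp) hB
  set D := (c⁻¹).toReal
  have hD : c⁻¹ ≠ ⊤ := by simpa using hc0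
  refine ⟨D ^ 2 / b + 1, by positivity, fun x₀ => ?_⟩
  rcases (hf.nonneg x₀).eq_or_lt with h0 | h0
  · rw [← h0]; positivity
  set ε := Real.sqrt (f x₀ * b)
  have hsub : {m | (2 : ℝ) • m - x₀ ∈ B} ⊆ {m | ENNReal.ofReal ε ≤ ENNReal.ofReal (f m)} := by
    intro m hm
    have hy : b < f ((2 : ℝ) • m - x₀) := hm
    have e : (1 / 2 : ℝ) • x₀ + (1 / 2 : ℝ) • ((2 : ℝ) • m - x₀) = m := by module
    have h12 : (0 : ℝ) ≤ 1 / 2 := by norm_num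
    have h1 := hc.concaveOn.1 h0 (hb.trans hy) h12 h12 (by norm_num)
    have h2 := hc.concaveOn.2 h0 (hb.trans hy) h12 h12 (by norm_num)
    rw [e] at h1 h2
    have h3 := mul_le_sq_of_concaveTransform hs h0 (hb.trans hy) h1 h2
    refine ENNReal.ofReal_le_ofReal (Real.sqrt_le_iff.2 ⟨h1.le, le_trans ?_ h3⟩)
    exact mul_le_mul_of_nonneg_left hy.le h0.le
  have h1 : ENNReal.ofReal ε * c ≤ 1 := by
    rw [hcdef, ← volume_preimage_reflection x₀ B, ← hf.lintegral_eq_one]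
    exact (mul_le_mul_right (measure_mono hsub) _).trans
      (mul_meas_ge_le_lintegral₀ hf.aemeasurable.ennreal_ofReal _)
  have h2 : ε ≤ D :=
    (ENNReal.ofReal_le_iff_le_toReal hD).1 (ENNReal.le_inv_iff_mul_le.2 h1)
  have h3 : f x₀ * b ≤ D ^ 2 := by
    rw [← Real.sq_sqrt (show 0 ≤ f x₀ * b by positivity)]
    exact pow_le_pow_left₀ (Real.sqrt_nonneg _) h2 2
  rw [← le_div_iff₀ hb] at h3
  linarith

lemma generalizedEntropy_le_of_le {W : EuclideanSpace ℝ (Fin d) → ℝ} {c : ℝ}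
    (hg : AEMeasurable g) (hW : Integrable W) (h : ∀ᵐ x, entropyIntegrand s (g x) ≤ W x)
    (hc : ∫ x, W x ≤ c) : generalizedEntropy s g ≤ (c : EReal) := by
  -- If the negative part is infinite the entropy is -∞, even when the positive part is infinite
  -- too.
  by_cases hN : ∫⁻ x, ENNReal.ofReal (-entropyIntegrand s (g x)) = ⊤
  · rw [generalizedEntropy, hN, EReal.coe_ennreal_top, EReal.sub_top]
    exact bot_le
  have hP : ∫⁻ x, ENNReal.ofReal (entropyIntegrand s (g x)) ≠ ⊤ :=
    ne_top_of_le_ne_top hW.lintegral_lt_top.ne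
      (lintegral_mono_ae (h.mono fun x hx => ENNReal.ofReal_le_ofReal hx))
  have hi := integrable_entropyIntegrand_of_lintegral_ne_top hg hP hN
  rw [generalizedEntropy_eq_integral hi, EReal.coe_le_coe_iff]
  exact (integral_mono_ae hi hW h).trans hc

/-- Integrate the tangent inequality for U at f(x), evaluated at g(x). The linear term is controlled
by Jensen for the concave function F = Φ∘f along Z; most of the work is integrability. -/
theorem IsSConcave.generalizedEntropy_le (hs : -1 < s) (hf : IsProbabilityDensity f)
    (hc : IsSConcave s f) (hg : IsProbabilityDensity g) {Ω : Type*} [MeasurableSpace Ω]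
    {P : Measure Ω} [IsProbabilityMeasure P] {n : ℕ} {X : Fin n → Ω → EuclideanSpace ℝ (Fin d)}
    (hX : ∀ i, HasLaw (X i) (lawOfDensity f) P) {w : Fin n → ℝ} (hw : ∀ i, 0 ≤ w i)
    (hw1 : ∑ i, w i = 1) (hZ : P.map (fun ω => ∑ i, w i • X i ω) = lawOfDensity g) :
    generalizedEntropy s g ≤ generalizedEntropy s f := by
  by_cases htop : generalizedEntropy s f = ⊤
  · rw [htop]; exact le_top
  have hbdd : s < 0 ∨ ∃ C : ℝ, 0 < C ∧ ∀ x, f x ≤ C := by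
    rcases lt_or_ge s 0 with h | h
    · exact .inl h
    · exact .inr (hc.bounded h hf)
  set F : EuclideanSpace ℝ (Fin d) → ℝ := fun x => concaveTransform s (f x) with hF
  -- Φ ≤ 0 for s < 0, and f is bounded for s ≥ 0. With Jensen's lower bound this sandwiches F(Z)
  -- between integrable functions.
  have hFtop : ∃ C : ℝ, ∀ x, 0 < f x → F x ≤ C := by
    rcases hbdd with h | ⟨C, hC, h⟩
    · refine ⟨0, fun x hx => ?_⟩
      simp only [hF, concaveTransform, if_neg h.ne]
      exact div_nonpos_of_nonneg_of_nonpos (by positivity) h.le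
    · exact ⟨concaveTransform s C, fun x hx => (concaveTransform_le_iff hx hC).2 (h x)⟩
  have hneg : ∫⁻ x, ENNReal.ofReal (-entropyIntegrand s (f x)) ≠ ⊤ := by
    rcases hbdd with h | ⟨C, hC, h⟩
    · have : ∀ x, ENNReal.ofReal (-entropyIntegrand s (f x)) = 0 := fun x => by
        rw [ENNReal.ofReal_eq_zero, entropyIntegrand, neg_neg, concaveTransform, if_neg h.ne]
        exact mul_nonpos_of_nonneg_of_nonpos (hf.nonneg x)
          (div_nonpos_of_nonneg_of_nonpos (Real.rpow_nonneg (hf.nonneg x) _) h.le)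
      simp [this]
    · exact lintegral_neg_entropyIntegrand_ne_top_of_le hf hC (.of_forall h)
  have hUf := integrable_entropyIntegrand_of_ne_top hf.aemeasurable htop hneg
  have hfF : Integrable fun x => f x * F x := by
    simpa [entropyIntegrand] using hUf.neg
  have hFm : AEStronglyMeasurable F volume :=
    ((measurable_concaveTransform s).comp_aemeasurable hf.aemeasurable).aestronglyMeasurable
  have hFf : Integrable F (lawOfDensity f) :=
    (integrable_lawOfDensity_iff hf.aemeasurable hf.nonneg).2 hfF
  set Z : Ω → EuclideanSpace ℝ (Fin d) := fun ω => ∑ i, w i • X i ω with hZdef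
  have hZm : AEMeasurable Z P := by
    have : ∀ i, AEMeasurable (X i) P := fun i => (hX i).aemeasurable
    fun_prop
  have hXpos : ∀ᵐ ω ∂P, ∀ i, 0 < f (X i ω) := by
    rw [ae_all_iff]
    intro i
    have := ae_pos_lawOfDensity hf.aemeasurable
    rw [← (hX i).map_eq] at this
    exact ae_of_ae_map (hX i).aemeasurable this
  have hXint : ∀ i, Integrable (fun ω => F (X i ω)) P := fun i => by
    have := hFf
    rw [← (hX i).map_eq] at this
    exact this.comp_aemeasurable (hX i).aemeasurable
  have hXeq : ∀ i, ∫ ω, F (X i ω) ∂P = ∫ x, f x * F x := fun i => by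
    rw [← integral_lawOfDensity hf.aemeasurable hf.nonneg, ← (hX i).map_eq,
      integral_map (hX i).aemeasurable]
    rw [(hX i).map_eq]; exact hFf.1
  have hconc : ∀ᵐ ω ∂P, 0 < f (Z ω) ∧ ∑ i, w i * F (X i ω) ≤ F (Z ω) := by
    filter_upwards [hXpos] with ω hω
    exact ⟨hc.concaveOn.1.sum_mem (fun i _ => hw i) hw1 fun i _ => hω i,
      hc.concaveOn.le_map_sum (fun i _ => hw i) hw1 fun i _ => hω i⟩
  have hsum : Integrable (fun ω => ∑ i, w i * F (X i ω)) P :=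
    integrable_finsetSum _ fun i _ => (hXint i).const_mul _
  have hFmg : AEStronglyMeasurable F (lawOfDensity g) :=
    hFm.mono_ac (lawOfDensity_absolutelyContinuous g)
  have hFZm : AEStronglyMeasurable (fun ω => F (Z ω)) P := by
    rw [← hZ] at hFmg
    exact hFmg.comp_aemeasurable hZm
  obtain ⟨C, hC⟩ := hFtop
  have hFZ : Integrable (fun ω => F (Z ω)) P :=
    integrable_of_le_of_le hFZm (hconc.mono fun ω h => h.2) (hconc.mono fun ω h => hC _ h.1)
      hsum (integrable_const C)
  have hFg : Integrable F (lawOfDensity g) := by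
    rw [← hZ] at hFmg ⊢
    exact (integrable_map_measure hFmg hZm).2 hFZ
  have hgF : Integrable fun x => g x * F x :=
    (integrable_lawOfDensity_iff hg.aemeasurable hg.nonneg).1 hFg
  have hmean : ∫ x, f x * F x ≤ ∫ x, g x * F x := by
    rw [← integral_lawOfDensity hg.aemeasurable hg.nonneg, ← hZ, integral_map hZm (by rwa [hZ])]
    calc ∫ x, f x * F x = ∑ i, w i * ∫ ω, F (X i ω) ∂P := by
          simp_rw [hXeq, ← Finset.sum_mul, hw1, one_mul]
      _ = ∫ ω, ∑ i, w i * F (X i ω) ∂P := by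
          rw [integral_finsetSum _ fun i _ => (hXint i).const_mul _]
          simp_rw [integral_const_mul]
      _ ≤ _ := integral_mono_ae hsum hFZ (hconc.mono fun ω h => h.2)
  -- Z stays in the convex set {f > 0}, so g vanishes almost everywhere on {f = 0}, where no tangent
  -- is available.
  have hgpos : ∀ᵐ x, 0 < g x → 0 < f x := by
    have h1 : ∀ᵐ x ∂lawOfDensity g, 0 < f x := by
      have hns : NullMeasurableSet {x | 0 < f x} (P.map Z) := by
        rw [hZ]
        exact (nullMeasurableSet_lt aemeasurable_const hf.aemeasurable).mono_ac
          (lawOfDensity_absolutelyContinuous g)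
      have h2 : ∀ᵐ ω ∂P, Z ω ∈ {x | 0 < f x} := hconc.mono fun ω h => h.1
      rw [← hZ]
      rw [ae_iff] at h2 ⊢
      exact (Measure.map_apply₀ hZm hns.compl).trans h2
    rw [lawOfDensity, ae_withDensity_iff' hg.aemeasurable.ennreal_ofReal] at h1
    exact h1.mono fun x hx hgx => hx (by simpa using hgx)
  -- The constant part of the slope contributes nothing after integration, since f and g both have
  -- mass one.
  set κ : ℝ := if s = 0 then 1 else 0
  set W : EuclideanSpace ℝ (Fin d) → ℝ := fun x => entropyIntegrand s (f x) -
    ((1 + s) * (g x * F x - f x * F x) + κ * (g x - f x)) with hWdef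
  have hI1 : Integrable fun x => (1 + s) * (g x * F x - f x * F x) :=
    (hgF.sub hfF).const_mul (1 + s)
  have hI2 : Integrable fun x => κ * (g x - f x) :=
    (hg.integrable.sub hf.integrable).const_mul κ
  have hW : Integrable W := hUf.sub (hI1.add hI2)
  rw [generalizedEntropy_eq_integral hUf]
  refine generalizedEntropy_le_of_le hg.aemeasurable hW ?_ ?_
  · filter_upwards [hgpos] with x hx
    rcases (hf.nonneg x).eq_or_lt with h0 | h0
    · have hg0 : g x = 0 := le_antisymm (not_lt.1 fun h => (hx h).ne h0) (hg.nonneg x)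
      simp [hWdef, hg0, ← h0]
    · refine (entropyIntegrand_le_tangent hs h0 (hg.nonneg x)).trans (le_of_eq ?_)
      simp only [hWdef, entropySlope, hF, κ]
      ring
  · have e : ∫ x, W x = (∫ x, entropyIntegrand s (f x)) -
        ((1 + s) * ((∫ x, g x * F x) - ∫ x, f x * F x) + κ * ((∫ x, g x) - ∫ x, f x)) := by
      rw [← integral_sub hgF hfF, ← integral_sub hg.integrable hf.integrable,
        ← integral_const_mul, ← integral_const_mul, ← integral_add hI1 hI2]
      exact integral_sub hUf (hI1.add hI2)
    rw [e, hg.integral_eq_one, hf.integral_eq_one]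
    have := mul_nonneg (show 0 ≤ 1 + s by linarith) (sub_nonneg.2 hmean)
    linarith

end Forward

/-! ### Midpoint couplings and finiteness of the entropy. -/

section Coupling

variable {d : ℕ} {f : EuclideanSpace ℝ (Fin d) → ℝ} {s : ℝ}

/-- The entropy of the midpoint of a coupling of `f` with itself is at most that of `f`, whenever
the midpoint has a density. -/
def MidpointCouplingLE (s : ℝ) (f : EuclideanSpace ℝ (Fin d) → ℝ) : Prop :=
  ∀ π : Measure (EuclideanSpace ℝ (Fin d) × EuclideanSpace ℝ (Fin d)),
    π.map Prod.fst = lawOfDensity f → π.map Prod.snd = lawOfDensity f →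
    ∀ g : EuclideanSpace ℝ (Fin d) → ℝ, Measurable g → (∀ x, 0 ≤ g x) →
      π.map (fun p => (1 / 2 : ℝ) • (p.1 + p.2)) = lawOfDensity g →
      generalizedEntropy s g ≤ generalizedEntropy s f

lemma MixtureEntropyLE.midpointCouplingLE (hs : -1 < s) (hf : IsProbabilityDensity f)
    (h : MixtureEntropyLE.{u} (1 + s) f (1 / 2)) : MidpointCouplingLE s f := by
  intro π h1 h2 g hg hg0 hmid
  have := hf.isProbabilityMeasure
  have hπ : IsProbabilityMeasure π := by
    refine ⟨?_⟩
    rw [← Set.preimage_univ (f := Prod.fst), ← Measure.map_apply measurable_fst MeasurableSet.univ,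
      h1, measure_univ]
  -- The coupling lives on the product space, lifted to the universe over which the hypothesis
  -- quantifies.
  have hup : Measurable (ULift.up.{u} : EuclideanSpace ℝ (Fin d) × EuclideanSpace ℝ (Fin d) → _) :=
    measurable_up
  have hP : IsProbabilityMeasure (π.map ULift.up.{u}) :=
    Measure.isProbabilityMeasure_map hup.aemeasurable
  have hm1 : Measurable fun ω : ULift.{u} (EuclideanSpace ℝ (Fin d) × EuclideanSpace ℝ (Fin d)) =>
      ω.down.1 := measurable_fst.comp measurable_down
  have hm2 : Measurable fun ω : ULift.{u} (EuclideanSpace ℝ (Fin d) × EuclideanSpace ℝ (Fin d)) =>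
      ω.down.2 := measurable_snd.comp measurable_down
  have hX : HasLaw (fun ω : ULift.{u} _ => ω.down.1) (lawOfDensity f) (π.map ULift.up.{u}) :=
    ⟨hm1.aemeasurable, by rw [Measure.map_map hm1 hup, ← h1]; rfl⟩
  have hY : HasLaw (fun ω : ULift.{u} _ => ω.down.2) (lawOfDensity f) (π.map ULift.up.{u}) :=
    ⟨hm2.aemeasurable, by rw [Measure.map_map hm2 hup, ← h2]; rfl⟩
  have key := h _ _ _ hP _ _ hX hY
  have e : (π.map ULift.up.{u}).map (fun ω => (1 / 2 : ℝ) • ω.down.1 + (1 - 1 / 2 : ℝ) • ω.down.2)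
      = lawOfDensity g := by
    have hm3 : Measurable fun ω : ULift.{u} (EuclideanSpace ℝ (Fin d) × EuclideanSpace ℝ (Fin d)) =>
        (1 / 2 : ℝ) • ω.down.1 + (1 - 1 / 2 : ℝ) • ω.down.2 := by
      have hm : Measurable fun p : EuclideanSpace ℝ (Fin d) × EuclideanSpace ℝ (Fin d) =>
        (1 / 2 : ℝ) • p.1 + (1 - 1 / 2 : ℝ) • p.2 := by fun_prop
      exact hm.comp measurable_down
    rw [Measure.map_map hm3 hup, ← hmid]
    congr 1
    funext p
    simp only [Function.comp]
    module
  rw [hX.map_eq, e] at key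
  exact (renyiEntropy_le_iff hs hf.aemeasurable hf.nonneg hg.aemeasurable hg0).1 key

lemma exists_superlevel_le_half (hf : IsProbabilityDensity f) (hfm : Measurable f) :
    ∃ M : ℝ, 0 < M ∧ lawOfDensity f {x | M < f x} ≤ 1 / 2 := by
  have := hf.isProbabilityMeasure
  have hlim := tendsto_measure_iInter_atTop (μ := lawOfDensity f)
    (s := fun n : ℕ => {x | (n : ℝ) < f x})
    (fun n => (measurableSet_lt measurable_const hfm).nullMeasurableSet)
    (fun m n hmn x (hx : (n : ℝ) < f x) =>
      lt_of_le_of_lt (b := (n : ℝ)) (by exact_mod_cast hmn) hx) ⟨0, measure_ne_top _ _⟩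
  have hempty : ⋂ n : ℕ, {x | (n : ℝ) < f x} = ∅ := by
    ext x
    simp only [Set.mem_iInter, Set.mem_ofPred_eq, Set.mem_empty_iff_false, iff_false, not_forall,
      not_lt]
    exact exists_nat_ge (f x)
  rw [hempty, measure_empty] at hlim
  obtain ⟨n, hn, hn0⟩ := ((hlim.eventually (gt_mem_nhds (by simp : (0 : ENNReal) < 1 / 2))).and
    (Filter.eventually_gt_atTop 0)).exists
  exact ⟨n, by exact_mod_cast hn0, hn.le⟩

lemma volume_preimage_midpoint (x : EuclideanSpace ℝ (Fin d))
    (T : Set (EuclideanSpace ℝ (Fin d))) :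
    volume {y | (1 / 2 : ℝ) • (x + y) ∈ T} = ENNReal.ofReal (2 ^ d) * volume T := by
  have e : {y | (1 / 2 : ℝ) • (x + y) ∈ T} = (fun y => x + y) ⁻¹' (((1 / 2 : ℝ) • ·) ⁻¹' T) := rfl
  rw [e, measure_preimage_add, Measure.addHaar_preimage_smul _ (by norm_num)]
  simp

/-- Every density admits a self-coupling whose midpoint has a bounded density. -/
lemma exists_coupling_bounded_midpoint (hf : IsProbabilityDensity f) (hfm : Measurable f) :
    ∃ π : Measure (EuclideanSpace ℝ (Fin d) × EuclideanSpace ℝ (Fin d)),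
      π.map Prod.fst = lawOfDensity f ∧ π.map Prod.snd = lawOfDensity f ∧
      ∃ C : ENNReal, C ≠ ⊤ ∧ ∀ T, MeasurableSet T →
        π.map (fun p => (1 / 2 : ℝ) • (p.1 + p.2)) T ≤ C * volume T := by
  have := hf.isProbabilityMeasure
  obtain ⟨M, hM, hp⟩ := exists_superlevel_le_half hf hfm
  set μ := lawOfDensity f with hμ
  set S := {x | M < f x} with hSdef
  have hS : MeasurableSet S := measurableSet_lt measurable_const hfm
  -- A is the tall part of the law, with mass p ≤ 1/2, and G the part with density at most M, with
  -- mass q ≥ p. A is coupled independently with a p/q share of G, in both orders, and the rest of G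
  -- with itself on the diagonal. Given the A-coordinate, the midpoint has density at most a
  -- multiple of 2^d M; the diagonal part contributes at most M.
  set A := μ.restrict S with hA
  set G := μ.restrict Sᶜ with hG
  set p := A Set.univ with hpdef
  set q := G Set.univ
  have hpS : p = μ S := by simp [hpdef, hA]
  have hAG : A + G = μ := Measure.restrict_add_restrict_compl hS
  have hpq : p + q = 1 := by
    have := congrArg (fun ν => ν Set.univ) hAG
    simpa using this
  have hphalf : p ≤ 1 / 2 := hpS ▸ hp
  have hptop : p ≠ ⊤ := measure_ne_top _ _
  have hqtop : q ≠ ⊤ := measure_ne_top _ _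
  have hple : p ≤ q := by
    by_contra! h
    have h1 : p + q < 1 / 2 + 1 / 2 :=
      ENNReal.add_lt_add_of_le_of_lt hptop hphalf (h.trans_le hphalf)
    rw [ENNReal.add_halves, hpq] at h1
    exact lt_irrefl _ h1
  have hq0 : q ≠ 0 := by
    intro h
    rw [h, nonpos_iff_eq_zero] at hple
    simp [h, hple] at hpq
  have hr : q⁻¹ * p ≤ 1 := by
    rw [mul_comm, ← div_eq_mul_inv]
    exact ENNReal.div_le_of_le_mul (by simpa using hple)
  have hGle : ∀ T, MeasurableSet T → G T ≤ ENNReal.ofReal M * volume T := by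
    intro T hT
    rw [hG, Measure.restrict_apply hT, hμ, lawOfDensity, withDensity_apply _ (hT.inter hS.compl)]
    calc ∫⁻ x in T ∩ Sᶜ, ENNReal.ofReal (f x) ≤ ∫⁻ x in T ∩ Sᶜ, ENNReal.ofReal M :=
          setLIntegral_mono measurable_const fun x hx =>
            ENNReal.ofReal_le_ofReal (not_lt.1 hx.2)
      _ = ENNReal.ofReal M * volume (T ∩ Sᶜ) := by simp
      _ ≤ _ := by gcongr; exact Set.inter_subset_left
  set mid : EuclideanSpace ℝ (Fin d) × EuclideanSpace ℝ (Fin d) → EuclideanSpace ℝ (Fin d) :=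
    fun p => (1 / 2 : ℝ) • (p.1 + p.2) with hmid
  have hmidm : Measurable mid := by fun_prop
  have hdiag : Measurable fun x : EuclideanSpace ℝ (Fin d) => (x, x) := by fun_prop
  have hd1 : (G.map fun x => (x, x)).map Prod.fst = G := by
    rw [Measure.map_map measurable_fst hdiag]
    exact Measure.map_id
  have hd2 : (G.map fun x => (x, x)).map Prod.snd = G := by
    rw [Measure.map_map measurable_snd hdiag]
    exact Measure.map_id
  set c := ENNReal.ofReal M * ENNReal.ofReal (2 ^ d) with hc
  have hb1 : ∀ T, MeasurableSet T → A.prod G (mid ⁻¹' T) ≤ c * volume T * p := by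
    intro T hT
    rw [Measure.prod_apply (hmidm hT)]
    calc _ ≤ ∫⁻ x, c * volume T ∂A := by
          refine lintegral_mono fun x => ?_
          rw [hc, mul_assoc, ← volume_preimage_midpoint x T]
          exact hGle _ (measurable_prodMk_left (hmidm hT))
      _ = _ := by simp [hpdef]
  have hb2 : ∀ T, MeasurableSet T → G.prod A (mid ⁻¹' T) ≤ c * volume T * p := by
    intro T hT
    rw [Measure.prod_apply_symm (hmidm hT)]
    calc _ ≤ ∫⁻ x, c * volume T ∂A := by
          refine lintegral_mono fun x => ?_
          rw [hc, mul_assoc, ← volume_preimage_midpoint x T]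
          refine le_trans (le_of_eq ?_) (hGle _ (measurable_prodMk_left (x := x) (hmidm hT)))
          congr 1
          ext y
          simp [hmid, add_comm]
      _ = _ := by simp [hpdef]
  refine ⟨q⁻¹ • A.prod G + q⁻¹ • G.prod A + (1 - q⁻¹ * p) • G.map fun x => (x, x), ?_, ?_,
    q⁻¹ * (c * p) + q⁻¹ * (c * p) + ENNReal.ofReal M, ?_, ?_⟩
  · rw [Measure.map_add _ _ measurable_fst, Measure.map_add _ _ measurable_fst,
      Measure.map_smul, Measure.map_smul, Measure.map_smul, hd1,
      Measure.map_fst_prod, Measure.map_fst_prod, smul_smul, smul_smul,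
      ENNReal.inv_mul_cancel hq0 hqtop, one_smul, add_assoc, ← add_smul, add_tsub_cancel_of_le hr,
      one_smul, hAG]
  · rw [Measure.map_add _ _ measurable_snd, Measure.map_add _ _ measurable_snd,
      Measure.map_smul, Measure.map_smul, Measure.map_smul, hd2,
      Measure.map_snd_prod, Measure.map_snd_prod, smul_smul, smul_smul,
      ENNReal.inv_mul_cancel hq0 hqtop, one_smul, add_comm ((q⁻¹ * p) • G), add_assoc, ← add_smul,
      add_tsub_cancel_of_le hr, one_smul, hAG]
  · refine ENNReal.add_ne_top.2 ⟨ENNReal.add_ne_top.2 ⟨?_, ?_⟩, ENNReal.ofReal_ne_top⟩ <;>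
    exact ENNReal.mul_ne_top (by simpa using hq0) (ENNReal.mul_ne_top
      (ENNReal.mul_ne_top ENNReal.ofReal_ne_top ENNReal.ofReal_ne_top) hptop)
  · intro T hT
    have h3 : (G.map fun x => (x, x)) (mid ⁻¹' T) = G T := by
      rw [Measure.map_apply hdiag (hmidm hT)]
      congr 1
      ext x
      have : (1 / 2 : ℝ) • (x + x) = x := by module
      simp only [Set.mem_preimage, hmid, this]
    rw [Measure.map_apply hmidm hT, Measure.add_apply, Measure.add_apply, Measure.smul_apply,
      Measure.smul_apply, Measure.smul_apply, h3, smul_eq_mul, smul_eq_mul, smul_eq_mul,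
      add_mul, add_mul]
    have h4 : q⁻¹ * (c * p) * volume T = q⁻¹ * (c * volume T * p) := by ring
    rw [h4]
    exact add_le_add (add_le_add (mul_le_mul_right (hb1 T hT) _) (mul_le_mul_right (hb2 T hT) _))
      ((mul_le_of_le_one_left' tsub_le_self).trans (hGle T hT))

/-- If the negative part were infinite, ∫U(f) would be -∞ and bound from above the entropy of every
midpoint; but a midpoint with bounded density has entropy above -∞. -/
lemma MidpointCouplingLE.integrable (hf : IsProbabilityDensity f)
    (hfm : Measurable f) (h : MidpointCouplingLE s f) (htop : generalizedEntropy s f ≠ ⊤) :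
    Integrable fun x => entropyIntegrand s (f x) := by
  refine integrable_entropyIntegrand_of_ne_top hf.aemeasurable htop fun hN => ?_
  have := hf.isProbabilityMeasure
  obtain ⟨π, h1, h2, C, hC, hle⟩ := exists_coupling_bounded_midpoint hf hfm
  have hm : Measurable fun p : EuclideanSpace ℝ (Fin d) × EuclideanSpace ℝ (Fin d) =>
    (1 / 2 : ℝ) • (p.1 + p.2) := by fun_prop
  set ν := π.map fun p => (1 / 2 : ℝ) • (p.1 + p.2) with hν
  have hπ : IsProbabilityMeasure π := by
    refine ⟨?_⟩
    rw [← Set.preimage_univ (f := Prod.fst), ← Measure.map_apply measurable_fst MeasurableSet.univ,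
      h1, measure_univ]
  have hνp : IsProbabilityMeasure ν := Measure.isProbabilityMeasure_map hm.aemeasurable
  have hac : ν ≪ volume := Measure.AbsolutelyContinuous.mk fun T hT h0 =>
    le_antisymm ((hle T hT).trans (by simp [h0])) (by simp)
  obtain ⟨g, hgm, hg, hνg⟩ := exists_density_of_absolutelyContinuous hac
  have hgC : ∀ᵐ x, g x ≤ C.toReal + 1 := by
    have : (fun x => ENNReal.ofReal (g x)) ≤ᵐ[volume] fun _ => C := by
      refine ae_le_of_forall_setLIntegral_le_of_sigmaFinite hgm.ennreal_ofReal fun T hT _ => ?_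
      rw [← withDensity_apply _ hT]
      change lawOfDensity g T ≤ _
      rw [← hνg, setLIntegral_const]
      exact hle T hT
    filter_upwards [this] with x hx
    have := (ENNReal.ofReal_le_iff_le_toReal hC).1 hx
    linarith
  have hfin := lintegral_neg_entropyIntegrand_ne_top_of_le (s := s) hg
    (by positivity : 0 < C.toReal + 1) hgC
  have hle' := h π h1 h2 g hgm hg.nonneg hνg
  rw [generalizedEntropy, generalizedEntropy, hN, EReal.coe_ennreal_top, EReal.sub_top,
    le_bot_iff, sub_eq_add_neg, EReal.add_eq_bot_iff, EReal.neg_eq_bot_iff,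
    EReal.coe_ennreal_eq_top_iff] at hle'
  exact hle'.elim (EReal.coe_ennreal_ne_bot _) hfin

end Coupling

/-! ### The mass-transfer perturbation. -/

section Transfer

variable {d : ℕ} {f : EuclideanSpace ℝ (Fin d) → ℝ} {s : ℝ}

/-- The density obtained by moving mass `τ` per unit volume from `E ± v` to `E`, together with the
coupling realizing it. -/
lemma exists_transfer_coupling (hfm : Measurable f) {E : Set (EuclideanSpace ℝ (Fin d))}
    (hE : MeasurableSet E) {τ : ℝ} (hτ : 0 < τ) {v : EuclideanSpace ℝ (Fin d)}
    (h0 : ∀ x, 0 ≤ f x - τ * E.indicator 1 (x - v) - τ * E.indicator 1 (x + v)) :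
    ∃ π : Measure (EuclideanSpace ℝ (Fin d) × EuclideanSpace ℝ (Fin d)),
      π.map Prod.fst = lawOfDensity f ∧ π.map Prod.snd = lawOfDensity f ∧
      π.map (fun p => (1 / 2 : ℝ) • (p.1 + p.2)) = lawOfDensity fun x =>
        f x - τ * E.indicator 1 (x - v) - τ * E.indicator 1 (x + v) + τ * E.indicator 1 x +
          τ * E.indicator 1 x := by
  set e : EuclideanSpace ℝ (Fin d) → ℝ := fun x => τ * E.indicator 1 x with he
  have hem : Measurable e := (measurable_const.indicator hE).const_mul τ
  have he0 : ∀ x, 0 ≤ e x := fun x => mul_nonneg hτ.le (Set.indicator_nonneg (by simp) x)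
  set k : EuclideanSpace ℝ (Fin d) → ℝ := fun x => f x - e (x - v) - e (x + v) with hk
  have hkm : Measurable k :=
    (hfm.sub (hem.comp (measurable_id.sub_const v))).sub (hem.comp (measurable_id.add_const v))
  have hk0 : ∀ x, 0 ≤ k x := h0
  have hdiag : Measurable fun x : EuclideanSpace ℝ (Fin d) => (x, x) := by fun_prop
  have hp1 : Measurable fun x : EuclideanSpace ℝ (Fin d) => (x + -v, x + v) := by fun_prop
  have hp2 : Measurable fun x : EuclideanSpace ℝ (Fin d) => (x + v, x + -v) := by fun_prop
  have hmid : Measurable fun p : EuclideanSpace ℝ (Fin d) × EuclideanSpace ℝ (Fin d) =>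
    (1 / 2 : ℝ) • (p.1 + p.2) := by fun_prop
  have hplus : (lawOfDensity e).map (fun x => x + v) = lawOfDensity fun x => e (x - v) :=
    map_add_lawOfDensity e v
  have hminus : (lawOfDensity e).map (fun x => x + -v) = lawOfDensity fun x => e (x + v) := by
    simpa [sub_neg_eq_add] using map_add_lawOfDensity e (-v)
  have hsplit : lawOfDensity f =
      lawOfDensity k + lawOfDensity (fun x => e (x - v)) + lawOfDensity fun x => e (x + v) := by
    have hm : Measurable fun x => k x + e (x - v) :=
      hkm.add (hem.comp (measurable_id.sub_const v))
    rw [← lawOfDensity_add hkm hk0 fun x => he0 _,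
      ← lawOfDensity_add hm (fun x => add_nonneg (hk0 x) (he0 _)) fun x => he0 _]
    congr 1
    funext x
    simp only [hk]
    ring
  -- The pair (x - v, x + v) and its swap carry equal mass, so each marginal recovers both
  -- translates removed from f, while both midpoints are x.
  refine ⟨(lawOfDensity k).map (fun x => (x, x)) + (lawOfDensity e).map (fun x => (x + -v, x + v))
    + (lawOfDensity e).map (fun x => (x + v, x + -v)), ?_, ?_, ?_⟩
  · rw [Measure.map_add _ _ measurable_fst, Measure.map_add _ _ measurable_fst,
      Measure.map_map measurable_fst hdiag, Measure.map_map measurable_fst hp1,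
      Measure.map_map measurable_fst hp2, hsplit, add_right_comm]
    exact congrArg₂ _ (congrArg₂ _ Measure.map_id hplus) hminus
  · rw [Measure.map_add _ _ measurable_snd, Measure.map_add _ _ measurable_snd,
      Measure.map_map measurable_snd hdiag, Measure.map_map measurable_snd hp1,
      Measure.map_map measurable_snd hp2, hsplit]
    exact congrArg₂ _ (congrArg₂ _ Measure.map_id hplus) hminus
  · have e1 : ∀ φ : EuclideanSpace ℝ (Fin d) → EuclideanSpace ℝ (Fin d) ×
        EuclideanSpace ℝ (Fin d), Measurable φ → (∀ x, (1 / 2 : ℝ) • ((φ x).1 + (φ x).2) = x) →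
        ∀ μ : Measure (EuclideanSpace ℝ (Fin d)),
          (μ.map φ).map (fun p => (1 / 2 : ℝ) • (p.1 + p.2)) = μ := fun φ hφ h μ => by
      rw [Measure.map_map hmid hφ]
      have : ((fun p : EuclideanSpace ℝ (Fin d) × EuclideanSpace ℝ (Fin d) =>
        (1 / 2 : ℝ) • (p.1 + p.2)) ∘ φ) = id := funext h
      rw [this, Measure.map_id]
    rw [Measure.map_add _ _ hmid, Measure.map_add _ _ hmid,
      e1 _ hdiag fun x => by module, e1 _ hp1 fun x => by module, e1 _ hp2 fun x => by module,
      ← lawOfDensity_add hkm hk0 he0]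
    exact (lawOfDensity_add (hkm.add hem) (fun x => add_nonneg (hk0 x) (he0 x)) he0).symm

lemma integrable_mul_indicator_of_bounded {E : Set (EuclideanSpace ℝ (Fin d))}
    (hE : MeasurableSet E) (hfin : volume E ≠ ⊤) {D : EuclideanSpace ℝ (Fin d) → ℝ}
    (hD : Measurable D) {B : ℝ} (hB : ∀ x ∈ E, |D x| ≤ B) :
    Integrable fun x => D x * E.indicator 1 x := by
  have h1 : Integrable (E.indicator fun _ => B) :=
    (integrable_indicator_iff hE).2 (integrableOn_const hfin)
  refine h1.mono' (hD.mul (measurable_const.indicator hE)).aestronglyMeasurable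
    (.of_forall fun x => ?_)
  by_cases hx : x ∈ E
  · simpa [hx] using hB x hx
  · simp [hx]

/-- E, E + v and E - v are pairwise disjoint, so the entropy change splits into three local terms,
which translate to the integral over E of a strictly positive function. Since the change is at most
0, E is null. -/
lemma MidpointCouplingLE.volume_eq_zero (hs : -1 < s) (hf0 : ∀ x, 0 ≤ f x)
    (hfm : Measurable f) (h : MidpointCouplingLE s f)
    (hU : Integrable fun x => entropyIntegrand s (f x))
    {E : Set (EuclideanSpace ℝ (Fin d))} (hE : MeasurableSet E) (hfin : volume E ≠ ⊤)
    {τ N : ℝ} (hτ : 0 < τ) {v : EuclideanSpace ℝ (Fin d)}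
    (hd1 : ∀ x ∈ E, x + v ∉ E) (hd2 : ∀ x ∈ E, x + v + v ∉ E)
    (hN : ∀ x ∈ E, f x ≤ N ∧ f (x + v) ≤ N ∧ f (x - v) ≤ N)
    (hlow : ∀ x ∈ E, τ < f (x + v) ∧ τ < f (x - v))
    (hgap : ∀ x ∈ E, 2 * concaveTransform s (f x + 2 * τ) <
      concaveTransform s (f (x + v) - τ) + concaveTransform s (f (x - v) - τ)) :
    volume E = 0 := by
  set U := entropyIntegrand s with hUdef
  have hUm : Measurable U := measurable_entropyIntegrand s
  set e : EuclideanSpace ℝ (Fin d) → ℝ := E.indicator 1 with he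
  have hd3 : ∀ x, x - v ∈ E → x + v ∉ E := fun x hx => by
    have := hd2 _ hx
    rwa [sub_add_cancel] at this
  have hd4 : ∀ x, x - v ∈ E → x ∉ E := fun x hx => by
    have := hd1 _ hx
    rwa [sub_add_cancel] at this
  have hk0 : ∀ x, 0 ≤ f x - τ * e (x - v) - τ * e (x + v) := by
    intro x
    by_cases h1 : x - v ∈ E
    · have := (hlow _ h1).1
      rw [sub_add_cancel] at this
      simp [he, h1, hd3 x h1]
      linarith
    · by_cases h2 : x + v ∈ E
      · have := (hlow _ h2).2
        rw [add_sub_cancel_right] at this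
        simp [he, h1, h2]
        linarith
      · simp [he, h1, h2, hf0 x]
  obtain ⟨π, hπ1, hπ2, hπ3⟩ := exists_transfer_coupling hfm hE hτ hk0
  set g : EuclideanSpace ℝ (Fin d) → ℝ := fun x =>
    f x - τ * e (x - v) - τ * e (x + v) + τ * e x + τ * e x with hg
  have hem : Measurable e := measurable_const.indicator hE
  have hgm : Measurable g :=
    (((hfm.sub ((hem.comp (measurable_id.sub_const v)).const_mul τ)).sub
      ((hem.comp (measurable_id.add_const v)).const_mul τ)).add (hem.const_mul τ)).add
      (hem.const_mul τ)
  have he0 : ∀ x, 0 ≤ e x := Set.indicator_nonneg (by simp)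
  have hg0 : ∀ x, 0 ≤ g x := fun x => by
    have := mul_nonneg hτ.le (he0 x)
    have := hk0 x
    simp only [hg]
    linarith
  have hle := h π hπ1 hπ2 g hgm hg0 hπ3
  set D0 : EuclideanSpace ℝ (Fin d) → ℝ := fun x => U (f x + 2 * τ) - U (f x) with hD0
  set D1 : EuclideanSpace ℝ (Fin d) → ℝ := fun x => U (f x - τ) - U (f x) with hD1
  have hD0m : Measurable D0 := (hUm.comp (hfm.add_const _)).sub (hUm.comp hfm)
  have hD1m : Measurable D1 := (hUm.comp (hfm.sub_const _)).sub (hUm.comp hfm)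
  -- All values of f on E and E ± v, before and after the transfer, lie in this compact interval;
  -- with E of finite volume the three changes are integrable.
  obtain ⟨B, hB⟩ : ∃ B, ∀ t ∈ Set.Icc 0 (N + 2 * τ), ‖U t‖ ≤ B :=
    isCompact_Icc.exists_bound_of_continuousOn
      ((continuousOn_entropyIntegrand hs).mono Set.Icc_subset_Ici_self)
  have hB' : ∀ a b : ℝ, 0 ≤ a → a ≤ N + 2 * τ → 0 ≤ b → b ≤ N + 2 * τ → |U a - U b| ≤ B + B :=
    fun a b ha ha' hb hb' => (norm_sub_le _ _).trans (add_le_add (hB _ ⟨ha, ha'⟩) (hB _ ⟨hb, hb'⟩))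
  have hI0 : Integrable fun x => D0 x * e x :=
    integrable_mul_indicator_of_bounded hE hfin hD0m fun x hx => by
      have h1 := hN x hx; have h2 := hf0 x
      exact hB' _ _ (by linarith) (by linarith) h2 (by linarith)
  have hI1 : Integrable fun x => D1 (x + v) * e x :=
    integrable_mul_indicator_of_bounded hE hfin (hD1m.comp (measurable_id.add_const v))
      fun x hx => by
        have h1 := hN x hx; have h2 := hlow x hx
        exact hB' _ _ (by linarith) (by linarith) (by linarith) (by linarith)
  have hI2 : Integrable fun x => D1 (x - v) * e x :=
    integrable_mul_indicator_of_bounded hE hfin (hD1m.comp (measurable_id.sub_const v))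
      fun x hx => by
        have h1 := hN x hx; have h2 := hlow x hx
        exact hB' _ _ (by linarith) (by linarith) (by linarith) (by linarith)
  have hI1' : Integrable fun x => D1 x * e (x - v) := by
    simpa using hI1.comp_sub_right v
  have hI2' : Integrable fun x => D1 x * e (x + v) := by
    simpa using hI2.comp_add_right v
  have hE1 : ∫ x, D1 x * e (x - v) = ∫ x, D1 (x + v) * e x := by
    simpa using integral_sub_right_eq_self (fun x => D1 (x + v) * e x) v
  have hE2 : ∫ x, D1 x * e (x + v) = ∫ x, D1 (x - v) * e x := by
    simpa using integral_add_right_eq_self (fun x => D1 (x - v) * e x) v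
  have hUg : (fun x => U (g x)) =
      fun x => U (f x) + (D0 x * e x + (D1 x * e (x - v) + D1 x * e (x + v))) := by
    funext x
    simp only [hg, hD0, hD1]
    by_cases h1 : x - v ∈ E
    · simp [he, h1, hd3 x h1, hd4 x h1]
    · by_cases h2 : x + v ∈ E
      · have h3 : x ∉ E := fun h3 => hd1 x h3 h2
        simp [he, h1, h2, h3]
      · by_cases h3 : x ∈ E
        · have : f x + τ + τ = f x + 2 * τ := by ring
          simp [he, h1, h2, h3, this]
        · simp [he, h1, h2, h3]
  have hI12 : Integrable fun x => D1 x * e (x - v) + D1 x * e (x + v) := hI1'.add hI2'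
  have hsum : Integrable fun x => D0 x * e x + (D1 x * e (x - v) + D1 x * e (x + v)) :=
    hI0.add hI12
  have hUgi : Integrable fun x => U (g x) := by
    rw [hUg]; exact hU.add hsum
  rw [generalizedEntropy_eq_integral hUgi, generalizedEntropy_eq_integral hU,
    EReal.coe_le_coe_iff] at hle
  change ∫ x, U (g x) ≤ _ at hle
  have hΨi : Integrable fun x => (D0 x + D1 (x + v) + D1 (x - v)) * e x := by
    simp only [add_mul]
    exact (hI0.add hI1).add hI2
  have hΨ : ∫ x, (D0 x + D1 (x + v) + D1 (x - v)) * e x ≤ 0 := by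
    have e1 : ∫ x, U (g x) = (∫ x, U (f x)) +
        ((∫ x, D0 x * e x) + ((∫ x, D1 x * e (x - v)) + ∫ x, D1 x * e (x + v))) := by
      rw [hUg, ← integral_add hI1' hI2', ← integral_add hI0 hI12]
      exact integral_add hU hsum
    have e2 : ∫ x, (D0 x + D1 (x + v) + D1 (x - v)) * e x =
        (∫ x, D0 x * e x) + (∫ x, D1 (x + v) * e x) + ∫ x, D1 (x - v) * e x := by
      simp only [add_mul]
      rw [← integral_add hI0 hI1]
      exact integral_add (hI0.add hI1) hI2
    rw [e2, ← hE1, ← hE2]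
    rw [e1] at hle
    linarith
  have hpos : ∀ x ∈ E, 0 < D0 x + D1 (x + v) + D1 (x - v) := fun x hx =>
    entropyIntegrand_transfer_lt hs hτ (hf0 x) (hlow x hx).1 (hlow x hx).2 (hgap x hx)
  have hnn : 0 ≤ fun x => (D0 x + D1 (x + v) + D1 (x - v)) * e x := fun x => by
    by_cases hx : x ∈ E
    · simpa [he, hx] using (hpos x hx).le
    · simp [he, hx]
  have hzero := (integral_eq_zero_iff_of_nonneg hnn hΨi).1
    (le_antisymm hΨ (integral_nonneg hnn))
  rw [measure_eq_zero_iff_ae_notMem]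
  filter_upwards [hzero] with x hx hxE
  have := hpos x hxE
  simp [he, hxE] at hx
  linarith

end Transfer

open Filter Topology

/-! ### Almost everywhere midpoint concavity. -/

section AEMidpoint

variable {d : ℕ} {f : EuclideanSpace ℝ (Fin d) → ℝ} {s : ℝ}

/-- Almost everywhere midpoint `s`-concavity, expressed through lower bounds. -/
def AEMidpointConcave (s : ℝ) (f : EuclideanSpace ℝ (Fin d) → ℝ) : Prop :=
  ∀ v, ∀ᵐ x, ∀ q : ℝ, 0 < q → 0 < f (x - v) → 0 < f (x + v) →
    2 * concaveTransform s q < concaveTransform s (f (x - v)) + concaveTransform s (f (x + v)) →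
    q ≤ f x

/-- For fixed v the bad points lie in countably many sets E k N, with transfer size τ = 1/(k+1) and
height bound N, each locally null by the transfer argument. The test value q > 0 avoids Φ(0), which
is a default value, and q > f(x) leaves room for f(x) + 2τ < q. -/
lemma MidpointCouplingLE.aeMidpointConcave (hs : -1 < s) (hf0 : ∀ x, 0 ≤ f x)
    (hfm : Measurable f) (h : MidpointCouplingLE s f)
    (hU : Integrable fun x => entropyIntegrand s (f x)) : AEMidpointConcave s f := by
  intro v
  rcases eq_or_ne v 0 with rfl | hv
  · refine .of_forall fun x q hq hx _ hlt => ?_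
    simp only [sub_zero, add_zero] at hx hlt
    exact ((concaveTransform_lt_iff hq hx).1 (by linarith)).le
  have hv0 : 0 < ‖v‖ := norm_pos_iff.2 hv
  set E : ℕ → ℕ → Set (EuclideanSpace ℝ (Fin d)) := fun k N =>
    {x | f x ≤ N ∧ f (x + v) ≤ N ∧ f (x - v) ≤ N ∧ 1 / ((k : ℝ) + 1) < f (x + v) ∧
      1 / ((k : ℝ) + 1) < f (x - v) ∧ 2 * concaveTransform s (f x + 2 * (1 / ((k : ℝ) + 1))) <
        concaveTransform s (f (x + v) - 1 / ((k : ℝ) + 1)) +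
          concaveTransform s (f (x - v) - 1 / ((k : ℝ) + 1))}
  have hFm := measurable_concaveTransform s
  have hfp : Measurable fun x => f (x + v) := hfm.comp (measurable_id.add_const v)
  have hfn : Measurable fun x => f (x - v) := hfm.comp (measurable_id.sub_const v)
  have hEm : ∀ k N, MeasurableSet (E k N) := fun k N =>
    (measurableSet_le hfm measurable_const).inter <|
    (measurableSet_le hfp measurable_const).inter <|
    (measurableSet_le hfn measurable_const).inter <|
    (measurableSet_lt measurable_const hfp).inter <|
    (measurableSet_lt measurable_const hfn).inter <|
    measurableSet_lt ((hFm.comp (hfm.add_const _)).const_mul 2)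
      ((hFm.comp (hfp.sub_const _)).add (hFm.comp (hfn.sub_const _)))
  have hnull : ∀ k N, volume (E k N) = 0 := by
    intro k N
    refine measure_null_of_locally_null _ fun x₀ _ => ?_
    refine ⟨E k N ∩ Metric.ball x₀ (‖v‖ / 4), inter_mem_nhdsWithin _
      (Metric.ball_mem_nhds _ (by positivity)), ?_⟩
    -- Such a ball is too small to meet its translates by v and 2v.
    have hdist : ∀ x ∈ Metric.ball x₀ (‖v‖ / 4), ∀ y ∈ Metric.ball x₀ (‖v‖ / 4),
        ‖y - x‖ < ‖v‖ := fun x hx y hy => by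
      rw [← dist_eq_norm]
      have := dist_triangle_right y x x₀
      rw [Metric.mem_ball] at hx hy
      linarith
    refine h.volume_eq_zero hs hf0 hfm hU (τ := 1 / ((k : ℝ) + 1)) (N := N) (v := v)
      ((hEm k N).inter measurableSet_ball)
      (ne_top_of_le_ne_top measure_ball_lt_top.ne (measure_mono Set.inter_subset_right))
      (by positivity) ?_ ?_ ?_ ?_ ?_
    · rintro x ⟨-, hx⟩ ⟨-, hy⟩
      have := hdist _ hx _ hy
      rw [add_sub_cancel_left] at this
      exact lt_irrefl _ this
    · rintro x ⟨-, hx⟩ ⟨-, hy⟩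
      have h1 := hdist _ hx _ hy
      have h2 : x + v + v - x = (2 : ℝ) • v := by module
      rw [h2, norm_smul, Real.norm_of_nonneg zero_le_two] at h1
      linarith
    · rintro x ⟨hx, -⟩
      exact ⟨hx.1, hx.2.1, hx.2.2.1⟩
    · rintro x ⟨hx, -⟩
      exact ⟨hx.2.2.2.1, hx.2.2.2.2.1⟩
    · rintro x ⟨hx, -⟩
      exact hx.2.2.2.2.2
  have hall : ∀ᵐ x, ∀ k N, x ∉ E k N := by
    rw [ae_all_iff]; intro k
    rw [ae_all_iff]; intro N
    exact measure_eq_zero_iff_ae_notMem.1 (hnull k N)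
  filter_upwards [hall] with x hx q hq h1 h2 hlt
  by_contra! hqf
  have hτ : Tendsto (fun k : ℕ => 1 / ((k : ℝ) + 1)) atTop (𝓝 0) :=
    tendsto_one_div_add_atTop_nhds_zero_nat
  have hlim : Tendsto (fun k : ℕ => concaveTransform s (f (x + v) - 1 / ((k : ℝ) + 1)) +
      concaveTransform s (f (x - v) - 1 / ((k : ℝ) + 1))) atTop
      (𝓝 (concaveTransform s (f (x + v)) + concaveTransform s (f (x - v)))) := by
    refine Tendsto.add ?_ ?_
    · refine (continuousAt_concaveTransform s h2).tendsto.comp ?_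
      simpa using tendsto_const_nhds.sub hτ
    · refine (continuousAt_concaveTransform s h1).tendsto.comp ?_
      simpa using tendsto_const_nhds.sub hτ
  have hlim2 : Tendsto (fun k : ℕ => f x + 2 * (1 / ((k : ℝ) + 1))) atTop (𝓝 (f x)) := by
    simpa using (tendsto_const_nhds (x := f x)).add (hτ.const_mul 2)
  obtain ⟨k, ⟨⟨hk1, hk2⟩, hk3⟩, hk4⟩ := (((hlim.eventually (lt_mem_nhds (by linarith :
    2 * concaveTransform s q < _))).and (hlim2.eventually (gt_mem_nhds hqf))).and
    (hτ.eventually (gt_mem_nhds h1)) |>.and (hτ.eventually (gt_mem_nhds h2))).exists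
  obtain ⟨N, hN⟩ := exists_nat_ge (max (f x) (max (f (x + v)) (f (x - v))))
  refine hx k N ⟨(le_max_left _ _).trans hN, ((le_max_left _ _).trans (le_max_right _ _)).trans hN,
    ((le_max_right _ _).trans (le_max_right _ _)).trans hN, hk4, hk3, lt_of_le_of_lt ?_ hk1⟩
  have hpos : 0 < f x + 2 * (1 / ((k : ℝ) + 1)) := add_pos_of_nonneg_of_pos (hf0 x) (by positivity)
  have := (concaveTransform_lt_iff (s := s) hpos hq).2 hk2
  linarith

end AEMidpoint

/-! ### Essential lower bounds near a point. -/

section Regularization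

variable {d : ℕ} {f : EuclideanSpace ℝ (Fin d) → ℝ} {s : ℝ}

/-- `f` is almost everywhere at least `t` in some neighbourhood of `x`. -/
def EssLowerBoundAt (f : EuclideanSpace ℝ (Fin d) → ℝ) (x : EuclideanSpace ℝ (Fin d)) (t : ℝ) :
    Prop :=
  ∃ δ > 0, ∀ᵐ z, z ∈ Metric.ball x δ → t ≤ f z

lemma EssLowerBoundAt.mono {x : EuclideanSpace ℝ (Fin d)} {t t' : ℝ} (h : EssLowerBoundAt f x t)
    (ht : t' ≤ t) : EssLowerBoundAt f x t' := by
  obtain ⟨δ, hδ, h⟩ := h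
  exact ⟨δ, hδ, h.mono fun z hz hzb => ht.trans (hz hzb)⟩

lemma EssLowerBoundAt.eventually {x : EuclideanSpace ℝ (Fin d)} {t : ℝ}
    (h : EssLowerBoundAt f x t) : ∀ᶠ y in 𝓝 x, EssLowerBoundAt f y t := by
  obtain ⟨δ, hδ, h⟩ := h
  filter_upwards [Metric.ball_mem_nhds x (half_pos hδ)] with y hy
  refine ⟨δ / 2, half_pos hδ, h.mono fun z hz hzb => hz ?_⟩
  rw [Metric.mem_ball] at *
  linarith [dist_triangle z y x]

/-- For one t the exceptional set is locally null, hence null; rational t suffice because bounds may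
be lowered. -/
lemma ae_le_of_essLowerBoundAt (f : EuclideanSpace ℝ (Fin d) → ℝ) :
    ∀ᵐ x, ∀ t, EssLowerBoundAt f x t → t ≤ f x := by
  have h1 : ∀ t, ∀ᵐ x, EssLowerBoundAt f x t → t ≤ f x := by
    intro t
    rw [ae_iff]
    refine measure_null_of_locally_null _ fun x hx => ?_
    simp only [Set.mem_ofPred_eq, Classical.not_imp] at hx
    obtain ⟨⟨δ, hδ, h⟩, -⟩ := hx
    refine ⟨{x | ¬(EssLowerBoundAt f x t → t ≤ f x)} ∩ Metric.ball x δ, inter_mem_nhdsWithin _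
      (Metric.ball_mem_nhds _ hδ), ?_⟩
    refine measure_mono_null ?_ (ae_iff.1 h)
    rintro y ⟨hy, hyb⟩
    simp only [Set.mem_ofPred_eq, Classical.not_imp] at hy ⊢
    exact ⟨hyb, hy.2⟩
  have h2 : ∀ᵐ x, ∀ t : ℚ, EssLowerBoundAt f x t → (t : ℝ) ≤ f x := ae_all_iff.2 fun t => h1 t
  filter_upwards [h2] with x hx t ht
  by_contra! hlt
  obtain ⟨q, hq1, hq2⟩ := exists_rat_btwn hlt
  exact absurd (hx q (ht.mono hq2.le)) (not_le.2 hq1)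

/-- In a small ball of volume V about the density point x, A occupies more than 3V/4. For m near x,
the sets of v with m + v, respectively m - v, in this portion of A both exceed 3V/4 and lie in a
ball of volume below 3V/2, so they overlap in positive measure. -/
lemma exists_reflection_pos_measure {A : Set (EuclideanSpace ℝ (Fin d))} (hA : MeasurableSet A)
    {x : EuclideanSpace ℝ (Fin d)}
    (hx : Tendsto (fun r => volume (A ∩ Metric.closedBall x r) / volume (Metric.closedBall x r))
      (𝓝[>] 0) (𝓝 1)) :
    ∃ δ > 0, ∀ m ∈ Metric.ball x δ, volume {v | m - v ∈ A ∧ m + v ∈ A} ≠ 0 := by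
  have h34 : ENNReal.ofReal (3 / 4) < 1 := by
    rw [ENNReal.ofReal_lt_one]; norm_num
  obtain ⟨ρ, hρ1, hρ0 : 0 < ρ⟩ :=
    ((hx.eventually (lt_mem_nhds h34)).and self_mem_nhdsWithin).exists
  have hcont : Tendsto (fun δ : ℝ => (ρ + δ) ^ d) (𝓝[>] 0) (𝓝 (ρ ^ d)) := by
    have : Continuous fun δ : ℝ => (ρ + δ) ^ d := by fun_prop
    simpa using (this.tendsto 0).mono_left nhdsWithin_le_nhds
  have hlt : ρ ^ d < 3 / 2 * ρ ^ d := by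
    have : 0 < ρ ^ d := by positivity
    linarith
  obtain ⟨δ, hδ1, hδ0 : 0 < δ⟩ :=
    ((hcont.eventually (gt_mem_nhds hlt)).and self_mem_nhdsWithin).exists
  refine ⟨δ, hδ0, fun m hm h0 => ?_⟩
  set A' := A ∩ Metric.closedBall x ρ with hA'
  have hA'm : MeasurableSet A' := hA.inter measurableSet_closedBall
  set V := volume (Metric.closedBall x ρ) with hV
  have hV0 : V ≠ 0 := (Metric.measure_closedBall_pos volume x hρ0).ne'
  have hVtop : V ≠ ⊤ := measure_closedBall_lt_top.ne
  have hlow : ENNReal.ofReal (3 / 4) * V < volume A' :=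
    (ENNReal.lt_div_iff_mul_lt (.inl hV0) (.inl hVtop)).1 hρ1
  set S1 := {v | m + v ∈ A'} with hS1
  set S2 := {v | m - v ∈ A'} with hS2
  have hm1 : volume S1 = volume A' := measure_preimage_add volume m A'
  have hm2 : volume S2 = volume A' := by
    have : S2 = (fun v => -v) ⁻¹' S1 := by
      ext v; simp [hS1, hS2, sub_eq_add_neg]
    rw [this, Measure.measure_preimage_neg, hm1]
  have hinter : volume (S1 ∩ S2) = 0 :=
    measure_mono_null (t := {v | m - v ∈ A ∧ m + v ∈ A})
      (fun v (hv : v ∈ S1 ∩ S2) => ⟨hv.2.1, hv.1.1⟩) h0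
  have hS1m : MeasurableSet S1 := (measurable_const_add m) hA'm
  have hS2m : MeasurableSet S2 := (measurable_const_sub m) hA'm
  have hsub : S1 ∪ S2 ⊆ Metric.closedBall 0 (ρ + δ) := by
    have hmx : ‖m - x‖ < δ := by rwa [← dist_eq_norm]
    rintro v (hv | hv)
    · have h1 : ‖m + v - x‖ ≤ ρ := by rw [← dist_eq_norm]; exact hv.2
      rw [mem_closedBall_zero_iff]
      have : v = (m + v - x) - (m - x) := by abel
      rw [this]
      linarith [norm_sub_le (m + v - x) (m - x)]
    · have h1 : ‖m - v - x‖ ≤ ρ := by rw [← dist_eq_norm]; exact hv.2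
      rw [mem_closedBall_zero_iff]
      have : v = (m - x) - (m - v - x) := by abel
      rw [this]
      linarith [norm_sub_le (m - x) (m - v - x)]
  have hup : volume (S1 ∪ S2) ≤ ENNReal.ofReal (3 / 2) * V := by
    refine (measure_mono hsub).trans ?_
    rw [hV, Measure.addHaar_closedBall _ _ (by positivity), Measure.addHaar_closedBall _ _ hρ0.le,
      finrank_euclideanSpace_fin, ← mul_assoc, ← ENNReal.ofReal_mul (by norm_num)]
    exact mul_le_mul_left (ENNReal.ofReal_le_ofReal hδ1.le) _
  have hadd := measure_union_add_inter S1 hS2m (μ := volume)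
  rw [hinter, add_zero, hm1, hm2] at hadd
  rw [hadd] at hup
  have h2 := ENNReal.add_lt_add hlow hlow
  rw [← add_mul, ← ENNReal.ofReal_add (by norm_num) (by norm_num)] at h2
  norm_num at h2 hup
  exact absurd h2 (not_lt.2 hup)

/-- Near a density point of {f > t}, every m is the midpoint of a positive measure of pairs from
that set, and for almost every m some such pair obeys midpoint concavity, forcing f(m) ≥ q for each
q < t. -/
lemma AEMidpointConcave.ae_essLowerBoundAt (hfm : Measurable f) (h : AEMidpointConcave s f) :
    ∀ᵐ x, ∀ b, 0 < b → b < f x → EssLowerBoundAt f x b := by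
  have h1 : ∀ t q : ℝ, 0 < q → q < t → ∀ᵐ x, t < f x → EssLowerBoundAt f x q := by
    intro t q hq hqt
    set A := {x | t < f x}
    have hA : MeasurableSet A := measurableSet_lt measurable_const hfm
    -- The null set of bad m depends on v; Fubini exchanges the quantifiers.
    have hae : ∀ᵐ m, ∀ᵐ v, m - v ∈ A ∧ m + v ∈ A → q ≤ f m := by
      rw [Measure.ae_ae_comm]
      · refine .of_forall fun v => ?_
        filter_upwards [h v] with m hm hv
        have ht1 : t < f (m - v) := hv.1
        have ht2 : t < f (m + v) := hv.2
        have h01 : 0 < f (m - v) := by linarith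
        have h02 : 0 < f (m + v) := by linarith
        refine hm q hq h01 h02 ?_
        have := (concaveTransform_lt_iff (s := s) hq h01).2 (by linarith)
        have := (concaveTransform_lt_iff (s := s) hq h02).2 (by linarith)
        linarith
      · have hm1 : Measurable fun p : EuclideanSpace ℝ (Fin d) × EuclideanSpace ℝ (Fin d) =>
          p.1 - p.2 := by fun_prop
        have hm2 : Measurable fun p : EuclideanSpace ℝ (Fin d) × EuclideanSpace ℝ (Fin d) =>
          p.1 + p.2 := by fun_prop
        have e : {p : EuclideanSpace ℝ (Fin d) × EuclideanSpace ℝ (Fin d) |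
            p.1 - p.2 ∈ A ∧ p.1 + p.2 ∈ A → q ≤ f p.1} =
            ((fun p => p.1 - p.2) ⁻¹' A ∩ (fun p => p.1 + p.2) ⁻¹' A)ᶜ ∪
              Prod.fst ⁻¹' {m | q ≤ f m} := by
          ext p
          simp only [Set.mem_ofPred_eq, Set.mem_union, Set.mem_compl_iff, Set.mem_inter_iff,
            Set.mem_preimage]
          tauto
        rw [e]
        exact ((hm1 hA).inter (hm2 hA)).compl.union
          (measurable_fst (measurableSet_le measurable_const hfm))
    have hdens := Besicovitch.ae_tendsto_measure_inter_div volume A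
    rw [ae_restrict_iff' hA] at hdens
    filter_upwards [hdens] with x hx hxt
    obtain ⟨δ, hδ, hm⟩ := exists_reflection_pos_measure hA (hx hxt)
    refine ⟨δ, hδ, hae.mono fun m hmae hmb => ?_⟩
    by_contra hcon
    refine hm m hmb ?_
    rw [measure_eq_zero_iff_ae_notMem]
    exact hmae.mono fun v hv hvA => hcon (hv hvA)
  have h2 : ∀ᵐ x, ∀ t q : ℚ, 0 < (q : ℝ) → (q : ℝ) < t → (t : ℝ) < f x →
      EssLowerBoundAt f x q := by
    rw [ae_all_iff]; intro t
    rw [ae_all_iff]; intro q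
    by_cases hq : 0 < (q : ℝ)
    · by_cases hqt : (q : ℝ) < t
      · filter_upwards [h1 t q hq hqt] with x hx _ _ using hx
      · exact .of_forall fun x _ h => absurd h hqt
    · exact .of_forall fun x h => absurd h hq
  filter_upwards [h2] with x hx b hb hbf
  obtain ⟨t, ht1, ht2⟩ := exists_rat_btwn hbf
  obtain ⟨q, hq1, hq2⟩ := exists_rat_btwn ht1
  exact (hx t q (hb.trans hq1) hq2 ht2).mono hq1.le

/-- One shift v = (y - x)/2 serves every z near the midpoint, since z - v is then near x and z + v
near y; so a single null set is discarded. -/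
lemma AEMidpointConcave.essLowerBoundAt_midpoint (h : AEMidpointConcave s f)
    {x y : EuclideanSpace ℝ (Fin d)} {a b q : ℝ} (ha : 0 < a) (hb : 0 < b) (hq : 0 < q)
    (hx : EssLowerBoundAt f x a) (hy : EssLowerBoundAt f y b)
    (hlt : 2 * concaveTransform s q < concaveTransform s a + concaveTransform s b) :
    EssLowerBoundAt f ((1 / 2 : ℝ) • (x + y)) q := by
  obtain ⟨δ₁, hδ₁, hx⟩ := hx
  obtain ⟨δ₂, hδ₂, hy⟩ := hy
  set v := (1 / 2 : ℝ) • (y - x) with hv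
  have h1 := (measurePreserving_sub_right volume v).quasiMeasurePreserving.ae hx
  have h2 := (measurePreserving_add_right volume v).quasiMeasurePreserving.ae hy
  refine ⟨min δ₁ δ₂, lt_min hδ₁ hδ₂, ?_⟩
  filter_upwards [h v, h1, h2] with z hz hz1 hz2 hzb
  rw [Metric.mem_ball, dist_eq_norm] at hzb
  have e1 : z - v - x = z - (1 / 2 : ℝ) • (x + y) := by rw [hv]; module
  have e2 : z + v - y = z - (1 / 2 : ℝ) • (x + y) := by rw [hv]; module
  have ha' := hz1 (by rw [Metric.mem_ball, dist_eq_norm, e1]; exact hzb.trans_le (min_le_left _ _))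
  have hb' := hz2 (by rw [Metric.mem_ball, dist_eq_norm, e2]; exact hzb.trans_le (min_le_right _ _))
  have hpa := ha.trans_le ha'
  have hpb := hb.trans_le hb'
  refine hz q hq hpa hpb ?_
  have := (concaveTransform_le_iff (s := s) ha hpa).2 ha'
  have := (concaveTransform_le_iff (s := s) hb hpb).2 hb'
  linarith

lemma map_midpoint_volume (x : EuclideanSpace ℝ (Fin d)) :
    (volume : Measure (EuclideanSpace ℝ (Fin d))).map (fun y => (1 / 2 : ℝ) • (x + y)) =
      ENNReal.ofReal (2 ^ d) • volume := by
  ext T hT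
  rw [Measure.map_apply (by fun_prop) hT, Measure.smul_apply, smul_eq_mul,
    ← volume_preimage_midpoint x T]
  rfl

/-- If every T were a bound at x₀, midpoint concavity with an arbitrarily large value there would
give f((x₀+y)/2) ≥ K f(y) almost everywhere, with K > 2^d. Integrating in y yields 2^d ≥ K. -/
lemma AEMidpointConcave.exists_not_essLowerBoundAt (hd : 1 ≤ d) (hs : -1 / (d : ℝ) < s)
    (hf : IsProbabilityDensity f) (hfm : Measurable f) (h : AEMidpointConcave s f)
    (x₀ : EuclideanSpace ℝ (Fin d)) : ∃ T, ¬EssLowerBoundAt f x₀ T := by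
  by_contra! hall
  obtain ⟨K, hK, hKb⟩ := exists_midpoint_transform_gt hd hs
  have hK0 : 0 < K := lt_trans (by positivity) hK
  have hφ : Measurable fun y : EuclideanSpace ℝ (Fin d) => (1 / 2 : ℝ) • (x₀ + y) := by fun_prop
  have hmid : ∀ᵐ y, ∀ t, EssLowerBoundAt f ((1 / 2 : ℝ) • (x₀ + y)) t →
      t ≤ f ((1 / 2 : ℝ) • (x₀ + y)) := by
    refine ae_of_ae_map (p := fun m => ∀ t, EssLowerBoundAt f m t → t ≤ f m) hφ.aemeasurable ?_
    rw [map_midpoint_volume]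
    exact Measure.ae_smul_measure (ae_le_of_essLowerBoundAt f) _
  have hle : ∀ᵐ y, K * f y ≤ f ((1 / 2 : ℝ) • (x₀ + y)) := by
    filter_upwards [hmid, h.ae_essLowerBoundAt hfm] with y hy1 hy2
    by_contra! hlt
    have hlt' : f ((1 / 2 : ℝ) • (x₀ + y)) / K < f y := by
      rw [div_lt_iff₀ hK0, mul_comm]; exact hlt
    obtain ⟨b, hb1, hb2⟩ := exists_between hlt'
    have hb0 : 0 < b := lt_of_le_of_lt (div_nonneg (hf.nonneg _) hK0.le) hb1
    obtain ⟨T, hT0, hT⟩ := hKb b hb0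
    have := hy1 _ (h.essLowerBoundAt_midpoint hT0 hb0 (by positivity) (hall T) (hy2 b hb0 hb2)
      (hT T le_rfl))
    rw [div_lt_iff₀ hK0, mul_comm] at hb1
    linarith
  have h1 : ENNReal.ofReal K ≤ ENNReal.ofReal (2 ^ d) := by
    calc ENNReal.ofReal K = ∫⁻ y, ENNReal.ofReal K * ENNReal.ofReal (f y) := by
          rw [lintegral_const_mul' _ _ ENNReal.ofReal_ne_top, hf.lintegral_eq_one, mul_one]
      _ ≤ ∫⁻ y, ENNReal.ofReal (f ((1 / 2 : ℝ) • (x₀ + y))) := by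
          refine lintegral_mono_ae (hle.mono fun y hy => ?_)
          rw [← ENNReal.ofReal_mul hK0.le]
          exact ENNReal.ofReal_le_ofReal hy
      _ = ∫⁻ z, ENNReal.ofReal (f z) ∂(volume.map fun y => (1 / 2 : ℝ) • (x₀ + y)) :=
          (lintegral_map hfm.ennreal_ofReal hφ).symm
      _ = _ := by
          rw [map_midpoint_volume, lintegral_smul_measure, hf.lintegral_eq_one, smul_eq_mul,
            mul_one]
  have := (ENNReal.ofReal_le_ofReal_iff (by positivity)).1 h1
  linarith

end Regularization

/-! ### The s-concave version. -/

section Version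

variable {d : ℕ} {f : EuclideanSpace ℝ (Fin d) → ℝ} {s : ℝ}

/-- A closed set of reals containing `0` and `1` and closed under midpoints contains `[0, 1]`. -/
lemma Icc_subset_of_isClosed_of_midpoint {Q : Set ℝ} (hQ : IsClosed Q) (h0 : (0 : ℝ) ∈ Q)
    (h1 : (1 : ℝ) ∈ Q) (hmid : ∀ a ∈ Q, ∀ b ∈ Q, (a + b) / 2 ∈ Q) : Set.Icc 0 1 ⊆ Q := by
  rintro t ⟨ht0, ht1⟩
  have hA : IsCompact (Q ∩ Set.Icc 0 t) := isCompact_Icc.inter_left hQ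
  have hB : IsCompact (Q ∩ Set.Icc t 1) := isCompact_Icc.inter_left hQ
  have ha := hA.sSup_mem ⟨0, h0, le_rfl, ht0⟩
  have hb := hB.sInf_mem ⟨1, h1, ht1, le_rfl⟩
  set a := sSup (Q ∩ Set.Icc 0 t)
  set b := sInf (Q ∩ Set.Icc t 1)
  have hm := hmid a ha.1 b hb.1
  have ha0 := ha.2.1
  have hat := ha.2.2
  have hbt := hb.2.1
  have hb1 := hb.2.2
  -- a is the last point of Q up to t and b the first from t on; their midpoint cannot fall inside a
  -- gap.
  rcases le_total ((a + b) / 2) t with h | h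
  · have : (a + b) / 2 ≤ a := le_csSup hA.bddAbove ⟨hm, by linarith, h⟩
    have : t = a := by linarith
    exact this ▸ ha.1
  · have : b ≤ (a + b) / 2 := csInf_le hB.bddBelow ⟨hm, h, by linarith⟩
    have : t = b := by linarith
    exact this ▸ hb.1

/-- A lower semicontinuous midpoint `s`-concave function is `s`-concave. -/
lemma IsSConcave.of_midpoint {g : EuclideanSpace ℝ (Fin d) → ℝ} (hg0 : ∀ x, 0 ≤ g x)
    (hlsc : ∀ x t, 0 < t → t < g x → ∀ᶠ y in 𝓝 x, t < g y)
    (hmid : ∀ x y, 0 < g x → 0 < g y → 0 < g ((1 / 2 : ℝ) • (x + y)) ∧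
      concaveTransform s (g x) + concaveTransform s (g y) ≤
        2 * concaveTransform s (g ((1 / 2 : ℝ) • (x + y)))) : IsSConcave s g := by
  set P : ℝ → Prop := fun t => ∀ x y, 0 < g x → 0 < g y → 0 < g ((1 - t) • x + t • y) ∧
    (1 - t) * concaveTransform s (g x) + t * concaveTransform s (g y) ≤
      concaveTransform s (g ((1 - t) • x + t • y))
  set Q : Set ℝ := {t | t ∈ Set.Icc 0 1 ∧ P t}
  have hQm : ∀ a ∈ Q, ∀ b ∈ Q, (a + b) / 2 ∈ Q := by
    rintro a ⟨⟨ha0, ha1⟩, ha⟩ b ⟨⟨hb0, hb1⟩, hb⟩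
    refine ⟨⟨by linarith, by linarith⟩, fun x y hx hy => ?_⟩
    obtain ⟨ha1, ha2⟩ := ha x y hx hy
    obtain ⟨hb1, hb2⟩ := hb x y hx hy
    obtain ⟨h1, h2⟩ := hmid _ _ ha1 hb1
    have e : (1 / 2 : ℝ) • ((1 - a) • x + a • y + ((1 - b) • x + b • y)) =
        (1 - (a + b) / 2) • x + ((a + b) / 2) • y := by module
    rw [e] at h1 h2
    exact ⟨h1, by linarith⟩
  have hQ0 : (0 : ℝ) ∈ Q := ⟨by simp, fun x y hx _ => by simpa using hx⟩
  have hQ1 : (1 : ℝ) ∈ Q := ⟨by simp, fun x y _ hy => by simpa using hy⟩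
  have hQc : IsClosed Q := by
    refine isClosed_of_closure_subset fun t ht => ?_
    obtain ⟨u, huQ, hu⟩ := mem_closure_iff_seq_limit.1 ht
    refine ⟨isClosed_Icc.mem_of_tendsto hu (.of_forall fun n => (huQ n).1), fun x y hx hy => ?_⟩
    set z := (1 - t) • x + t • y with hz
    have key : ∀ θ : ℝ, 0 < θ → θ < 1 → 0 < g z ∧
        (1 - t) * concaveTransform s (θ * g x) + t * concaveTransform s (θ * g y) ≤
          concaveTransform s (g z) := by
      intro θ hθ0 hθ1
      have hax : 0 < θ * g x := mul_pos hθ0 hx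
      have hay : 0 < θ * g y := mul_pos hθ0 hy
      -- Lower semicontinuity at z would point the wrong way. Instead both endpoints move by (t - u
      -- n)(y - x), so that weight u n reproduces z exactly, and semicontinuity is used at x and y;
      -- θ < 1 absorbs the loss.
      have hshift : ∀ w : EuclideanSpace ℝ (Fin d),
          Tendsto (fun n => w + (t - u n) • (y - x)) atTop (𝓝 w) := fun w => by
        have h1 : Tendsto (fun n => t - u n) atTop (𝓝 0) := by
          simpa using (tendsto_const_nhds (x := t)).sub hu
        simpa using (tendsto_const_nhds (x := w)).add (h1.smul_const (y - x))
      have hall : ∀ᶠ n in atTop, 0 < g z ∧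
          (1 - u n) * concaveTransform s (θ * g x) + u n * concaveTransform s (θ * g y) ≤
            concaveTransform s (g z) := by
        filter_upwards [(hshift x).eventually (hlsc x _ hax (mul_lt_of_lt_one_left hx hθ1)),
          (hshift y).eventually (hlsc y _ hay (mul_lt_of_lt_one_left hy hθ1))] with n hn1 hn2
        obtain ⟨⟨hu0, hu1⟩, hP⟩ := huQ n
        obtain ⟨h1, h2⟩ := hP _ _ (hax.trans hn1) (hay.trans hn2)
        have e : (1 - u n) • (x + (t - u n) • (y - x)) + u n • (y + (t - u n) • (y - x)) = z := by
          rw [hz]; module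
        rw [e] at h1 h2
        refine ⟨h1, le_trans (add_le_add ?_ ?_) h2⟩
        · exact mul_le_mul_of_nonneg_left
            ((concaveTransform_lt_iff hax (hax.trans hn1)).2 hn1).le (by linarith)
        · exact mul_le_mul_of_nonneg_left
            ((concaveTransform_lt_iff hay (hay.trans hn2)).2 hn2).le hu0
      refine ⟨hall.exists.choose_spec.1, le_of_tendsto ?_ (hall.mono fun n hn => hn.2)⟩
      exact (((tendsto_const_nhds (x := (1 : ℝ))).sub hu).mul_const _).add (hu.mul_const _)
    refine ⟨(key (1 / 2) (by norm_num) (by norm_num)).1, ?_⟩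
    have hlim : ∀ c : ℝ, 0 < c → Tendsto (fun θ : ℝ => concaveTransform s (θ * c)) (𝓝[<] 1)
        (𝓝 (concaveTransform s c)) := fun c hc => by
      refine (continuousAt_concaveTransform s hc).tendsto.comp ?_
      have : Continuous fun θ : ℝ => θ * c := by fun_prop
      simpa using (this.tendsto 1).mono_left nhdsWithin_le_nhds
    refine le_of_tendsto (((hlim _ hx).const_mul (1 - t)).add ((hlim _ hy).const_mul t)) ?_
    filter_upwards [Ioo_mem_nhdsLT (zero_lt_one' ℝ)] with θ hθ using (key θ hθ.1 hθ.2).2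
  have hsub := Icc_subset_of_isClosed_of_midpoint hQc hQ0 hQ1 hQm
  refine .of_concaveOn hg0 ⟨fun x hx y hy a b ha hb hab => ?_, fun x hx y hy a b ha hb hab => ?_⟩
  · obtain rfl : a = 1 - b := by linarith
    exact ((hsub ⟨hb, by linarith⟩).2 x y hx hy).1
  · obtain rfl : a = 1 - b := by linarith
    exact ((hsub ⟨hb, by linarith⟩).2 x y hx hy).2

/-- The two a.e. comparisons of f with its essential lower bounds identify the regularization g with
f; the bounds persist near a point and pass to midpoints, so g is lower semicontinuous and midpoint
concave. -/
theorem AEMidpointConcave.hasSConcaveVersion (hd : 1 ≤ d) (hs : -1 / (d : ℝ) < s)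
    (hf : IsProbabilityDensity f) (hfm : Measurable f) (h : AEMidpointConcave s f) :
    HasSConcaveVersion s f := by
  set T : EuclideanSpace ℝ (Fin d) → Set ℝ := fun x => {t | 0 ≤ t ∧ EssLowerBoundAt f x t} with hT
  set g : EuclideanSpace ℝ (Fin d) → ℝ := fun x => sSup (T x) with hg
  have hT0 : ∀ x, (0 : ℝ) ∈ T x := fun x =>
    ⟨le_rfl, 1, one_pos, .of_forall fun z _ => hf.nonneg z⟩
  have hbdd : ∀ x, BddAbove (T x) := fun x => by
    obtain ⟨B, hB⟩ := h.exists_not_essLowerBoundAt hd hs hf hfm x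
    exact ⟨B, fun t ht => le_of_not_gt fun hlt => hB (ht.2.mono hlt.le)⟩
  have hle : ∀ x t, 0 ≤ t → EssLowerBoundAt f x t → t ≤ g x := fun x t ht h =>
    le_csSup (hbdd x) ⟨ht, h⟩
  have hlt : ∀ x t, t < g x → EssLowerBoundAt f x t := fun x t ht => by
    obtain ⟨t', ht', htt'⟩ := exists_lt_of_lt_csSup ⟨0, hT0 x⟩ ht
    exact ht'.2.mono htt'.le
  have hg0 : ∀ x, 0 ≤ g x := fun x => le_csSup (hbdd x) (hT0 x)
  have hae : g =ᵐ[volume] f := by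
    filter_upwards [ae_le_of_essLowerBoundAt f, h.ae_essLowerBoundAt hfm] with x hx1 hx2
    refine le_antisymm (csSup_le ⟨0, hT0 x⟩ fun t ht => hx1 t ht.2) ?_
    refine le_of_forall_lt fun b hb => ?_
    rcases lt_or_ge b 0 with hb0 | hb0
    · exact hb0.trans_le (hg0 x)
    obtain ⟨c, hc1, hc2⟩ := exists_between hb
    exact hc1.trans_le (hle x c (hb0.trans hc1.le) (hx2 c (hb0.trans_lt hc1) hc2))
  refine ⟨g, hae, .of_midpoint hg0 (fun x t ht htg => ?_) fun x y hx hy => ?_⟩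
  · obtain ⟨c, hc1, hc2⟩ := exists_between htg
    filter_upwards [(hlt x c hc2).eventually] with y hy
    exact hc1.trans_le (hle y c (ht.trans hc1).le hy)
  set m := (1 / 2 : ℝ) • (x + y) with hm
  have key : ∀ q, 0 < q → 2 * concaveTransform s q < concaveTransform s (g x) +
      concaveTransform s (g y) → q ≤ g m := by
    intro q hq hlt'
    have hlim : ∀ c : ℝ, 0 < c → Tendsto (fun θ : ℝ => concaveTransform s (θ * c)) (𝓝[<] 1)
        (𝓝 (concaveTransform s c)) := fun c hc => by
      refine (continuousAt_concaveTransform s hc).tendsto.comp ?_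
      have : Continuous fun θ : ℝ => θ * c := by fun_prop
      simpa using (this.tendsto 1).mono_left nhdsWithin_le_nhds
    -- The suprema g(x), g(y) need not be attained; scaling by θ < 1 gives genuine essential bounds.
    obtain ⟨θ, hθ1, hθ⟩ := ((((hlim _ hx).add (hlim _ hy)).eventually (lt_mem_nhds hlt')).and
      (Ioo_mem_nhdsLT (zero_lt_one' ℝ))).exists
    exact hle m q hq.le (h.essLowerBoundAt_midpoint (mul_pos hθ.1 hx) (mul_pos hθ.1 hy) hq
      (hlt x _ (mul_lt_of_lt_one_left hx hθ.2)) (hlt y _ (mul_lt_of_lt_one_left hy hθ.2)) hθ1)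
  have hpos : 0 < g m := by
    -- Positivity at the midpoint comes first, since Φ is meaningful and continuous only on positive
    -- values.
    have hmin : 0 < min (g x) (g y) / 2 := half_pos (lt_min hx hy)
    refine hmin.trans_le (key _ hmin ?_)
    have h1 := (concaveTransform_lt_iff (s := s) hmin hx).2
      ((half_lt_self (lt_min hx hy)).trans_le (min_le_left _ _))
    have h2 := (concaveTransform_lt_iff (s := s) hmin hy).2
      ((half_lt_self (lt_min hx hy)).trans_le (min_le_right _ _))
    linarith
  refine ⟨hpos, ?_⟩
  by_contra! hcon
  have hc : Tendsto (fun q => 2 * concaveTransform s q) (𝓝[>] (g m))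
      (𝓝 (2 * concaveTransform s (g m))) :=
    ((continuousAt_concaveTransform s hpos).tendsto.mono_left nhdsWithin_le_nhds).const_mul 2
  obtain ⟨q, hq1, hq2 : g m < q⟩ :=
    ((hc.eventually (gt_mem_nhds hcon)).and self_mem_nhdsWithin).exists
  exact absurd (key q (hpos.trans hq2) hq1) (not_le.2 hq2)

end Version

/-! ### Assembling the equivalences. -/

section Main

variable {d : ℕ} {f : EuclideanSpace ℝ (Fin d) → ℝ} {s : ℝ}

lemma HasSConcaveVersion.couplingEntropies_le (hs : -1 < s) (hf : IsProbabilityDensity f)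
    (hc : HasSConcaveVersion s f) {n : ℕ} {w : Fin n → ℝ} (hw : ∀ i, 0 ≤ w i)
    (hw1 : ∑ i, w i = 1) {h : EReal} (hh : h ∈ couplingEntropies.{u} (1 + s) f w) :
    h ≤ renyiEntropy (1 + s) (lawOfDensity f) := by
  obtain ⟨f', hff', hc'⟩ := hc
  have hf' : IsProbabilityDensity f' := hf.congr hff'.symm hc'.1
  obtain ⟨Ω, _, P, _, X, hX, rfl⟩ := hh
  rw [← lawOfDensity_congr hff'] at hX ⊢
  have hZm : AEMeasurable (fun ω => ∑ i, w i • X i ω) P := by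
    have : ∀ i, AEMeasurable (X i) P := fun i => (hX i).aemeasurable
    fun_prop
  have := Measure.isProbabilityMeasure_map hZm
  by_cases hac : P.map (fun ω => ∑ i, w i • X i ω) ≪ volume
  · obtain ⟨g, -, hg, hZ⟩ := exists_density_of_absolutelyContinuous hac
    rw [hZ, renyiEntropy_le_iff hs hf'.aemeasurable hf'.nonneg hg.aemeasurable hg.nonneg]
    exact hc'.generalizedEntropy_le hs hf' hg hX hw hw1 hZ
  · rw [renyiEntropy, if_neg hac]
    exact bot_le

lemma HasSConcaveVersion.mixtureEntropyLE (hs : -1 < s) (hf : IsProbabilityDensity f)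
    (hc : HasSConcaveVersion s f) {t : ℝ} (ht0 : 0 < t) (ht1 : t < 1) :
    MixtureEntropyLE.{u} (1 + s) f t := by
  intro Ω _ P _ X Y hX hY
  rw [hX.map_eq]
  refine hc.couplingEntropies_le.{u} hs hf (n := 2) (w := ![t, 1 - t]) ?_ ?_
    ⟨Ω, _, P, ‹_›, ![X, Y], ?_, ?_⟩
  · intro i; fin_cases i <;> simp <;> linarith
  · simp [Fin.sum_univ_two]
  · intro i; fin_cases i
    · exact hX
    · exact hY
  · simp [Fin.sum_univ_two]

/-- Taking all X i equal makes the weighted sum equal to that common vector, so the supremum is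
attained. -/
lemma renyiEntropy_mem_couplingEntropies (hf : IsProbabilityDensity f) (r : ℝ) {n : ℕ}
    {w : Fin n → ℝ} (hw1 : ∑ i, w i = 1) :
    renyiEntropy r (lawOfDensity f) ∈ couplingEntropies.{u} r f w := by
  have := hf.isProbabilityMeasure
  have hup : Measurable (ULift.up.{u} : EuclideanSpace ℝ (Fin d) → _) := measurable_up
  have hdown : Measurable (ULift.down.{u} : _ → EuclideanSpace ℝ (Fin d)) := measurable_down
  have hlaw : ((lawOfDensity f).map ULift.up.{u}).map ULift.down = lawOfDensity f := by
    rw [Measure.map_map hdown hup]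
    exact Measure.map_id
  refine ⟨_, _, (lawOfDensity f).map ULift.up.{u}, Measure.isProbabilityMeasure_map
    hup.aemeasurable, fun _ => ULift.down, fun i => ⟨hdown.aemeasurable, hlaw⟩, ?_⟩
  simp_rw [← Finset.sum_smul, hw1, one_smul]
  rw [hlaw]

/-- The weights (1/2, 1/2, 0, …, 0) reduce any n ≥ 2 to the midpoint inequality. -/
lemma MixtureEntropyLE.of_sSup_couplingEntropies {r : ℝ} {n : ℕ} (hn : 2 ≤ n)
    (h : ∀ w : Fin n → ℝ, (∀ i, 0 ≤ w i) → ∑ i, w i = 1 →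
      sSup (couplingEntropies.{u} r f w) = renyiEntropy r (lawOfDensity f)) :
    MixtureEntropyLE.{u} r f (1 / 2) := by
  intro Ω _ P _ X Y hX hY
  obtain ⟨m, rfl⟩ : ∃ m, n = m + 2 := ⟨n - 2, by omega⟩
  set w : Fin (m + 2) → ℝ := Fin.cons (1 / 2) (Fin.cons (1 / 2) fun _ => 0) with hw
  set Z : Fin (m + 2) → Ω → EuclideanSpace ℝ (Fin d) := Fin.cons X fun _ => Y with hZ
  have hw0 : ∀ i, 0 ≤ w i := by
    intro i
    refine Fin.cases (by simp [hw]) (fun i => ?_) i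
    refine Fin.cases (by simp [hw]) (fun i => by simp [hw]) i
  have hw1 : ∑ i, w i = 1 := by
    simp only [hw, Fin.sum_univ_succ, Fin.cons_zero, Fin.cons_succ, Finset.sum_const_zero]
    norm_num
  rw [hX.map_eq, ← h w hw0 hw1]
  refine le_sSup ⟨Ω, _, P, ‹_›, Z, fun i => ?_, ?_⟩
  · refine Fin.cases hX (fun i => hY) i
  · congr 2
    funext ω
    simp only [hw, hZ, Fin.sum_univ_succ, Fin.cons_zero, Fin.cons_succ, zero_smul,
      Finset.sum_const_zero, add_zero]
    norm_num

lemma MixtureEntropyLE.hasSConcaveVersion (hd : 1 ≤ d) (hs : -1 / (d : ℝ) < s)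
    (hf : IsProbabilityDensity f) (htop : renyiEntropy (1 + s) (lawOfDensity f) ≠ ⊤)
    (h : MixtureEntropyLE.{u} (1 + s) f (1 / 2)) : HasSConcaveVersion s f := by
  have hs1 : -1 < s := by
    refine lt_of_le_of_lt ?_ hs
    rw [neg_div, neg_le_neg_iff]
    exact div_le_one_of_le₀ (by exact_mod_cast hd) (by positivity)
  have := hf.isProbabilityMeasure
  -- The converse is run on a Borel version with the same law.
  obtain ⟨f', hfm, hf', hlaw⟩ :=
    exists_density_of_absolutelyContinuous (lawOfDensity_absolutelyContinuous f)
  have hae : f' =ᵐ[volume] f := by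
    have h1 := rnDeriv_lawOfDensity hf.aemeasurable
    rw [hlaw] at h1
    filter_upwards [h1, rnDeriv_lawOfDensity hf'.aemeasurable] with x hx hx'
    rw [hx', ENNReal.ofReal_eq_ofReal_iff (hf'.nonneg x) (hf.nonneg x)] at hx
    exact hx
  have h' : MixtureEntropyLE.{u} (1 + s) f' (1 / 2) := by
    intro Ω _ P _ X Y hX hY
    rw [← hlaw] at hX hY
    exact h Ω _ P ‹_› X Y hX hY
  rw [hlaw] at htop
  have hm := h'.midpointCouplingLE hs1 hf'
  have hU := hm.integrable hf' hfm
    (generalizedEntropy_ne_top hs1 hf'.aemeasurable hf'.nonneg htop)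
  obtain ⟨g, hg, hgc⟩ :=
    (hm.aeMidpointConcave hs1 hf'.nonneg hfm hU).hasSConcaveVersion hd hs hf' hfm
  exact ⟨g, hg.trans hae, hgc⟩

end Main
end

theorem mainTheorem4 {d : ℕ} (hd : 1 ≤ d) (s r : ℝ) (hs : -1 / (d : ℝ) < s) (hr : r = 1 + s)
    (f : EuclideanSpace ℝ (Fin d) → ℝ) (hf : IsProbabilityDensity f) :
    -- unconditional implications
    (HasSConcaveVersion s f → ∀ t : ℝ, 0 < t → t < 1 → MixtureEntropyLE.{u} r f t) ∧
    ((∀ t : ℝ, 0 < t → t < 1 → MixtureEntropyLE.{u} r f t) → MixtureEntropyLE.{u} r f (1 / 2)) ∧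
    (∀ n : ℕ, 2 ≤ n → HasSConcaveVersion s f →
      ∀ w : Fin n → ℝ, (∀ i, 0 ≤ w i) → ∑ i, w i = 1 →
        sSup (couplingEntropies.{u} r f w) = renyiEntropy r (lawOfDensity f)) ∧
    -- the characterizations, for densities whose entropy of order `r` is not `+∞`
    (renyiEntropy r (lawOfDensity f) ≠ ⊤ →
      List.TFAE [
        HasSConcaveVersion s f,
        ∀ t : ℝ, 0 < t → t < 1 → MixtureEntropyLE.{u} r f t,
        MixtureEntropyLE.{u} r f (1 / 2)] ∧
      ∀ n : ℕ, 2 ≤ n →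
        ((∀ w : Fin n → ℝ, (∀ i, 0 ≤ w i) → ∑ i, w i = 1 →
            sSup (couplingEntropies.{u} r f w) = renyiEntropy r (lawOfDensity f)) ↔
          HasSConcaveVersion s f)) := by
  subst hr
  have hs1 : -1 < s := by
    refine lt_of_le_of_lt ?_ hs
    rw [neg_div, neg_le_neg_iff]
    exact div_le_one_of_le₀ (by exact_mod_cast hd) (by positivity)
  have h12 : HasSConcaveVersion s f →
      ∀ t : ℝ, 0 < t → t < 1 → MixtureEntropyLE.{u} (1 + s) f t :=
    fun hc t ht0 ht1 => hc.mixtureEntropyLE hs1 hf ht0 ht1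
  have h23 : (∀ t : ℝ, 0 < t → t < 1 → MixtureEntropyLE.{u} (1 + s) f t) →
      MixtureEntropyLE.{u} (1 + s) f (1 / 2) :=
    fun h => h _ (by norm_num) (by norm_num)
  have h14 : ∀ n : ℕ, 2 ≤ n → HasSConcaveVersion s f →
      ∀ w : Fin n → ℝ, (∀ i, 0 ≤ w i) → ∑ i, w i = 1 →
        sSup (couplingEntropies.{u} (1 + s) f w) = renyiEntropy (1 + s) (lawOfDensity f) :=
    fun n _ hc w hw hw1 => le_antisymm
      (sSup_le fun h hh => hc.couplingEntropies_le.{u} hs1 hf hw hw1 hh)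
      (le_sSup (renyiEntropy_mem_couplingEntropies hf _ hw1))
  refine ⟨h12, h23, h14, fun htop => ⟨?_, fun n hn => ⟨fun h => ?_, h14 n hn⟩⟩⟩
  · tfae_have 1 → 2 := h12
    tfae_have 2 → 3 := h23
    tfae_have 3 → 1 := fun h => h.hasSConcaveVersion hd hs hf htop
    tfae_finish
  · exact (MixtureEntropyLE.of_sSup_couplingEntropies hn h).hasSConcaveVersion hd hs hf htop
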